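/- Let $\eta>0$, $T>0$, and let $f^{\mathrm{in}}\in L^1(\mathbb{R}^+)\cap L^\infty(\mathbb{R}^+)$ with $f^{\mathrm{in}}\ge 0$ a.e., where $\mathbb{R}^+=[0,\infty)$. For every $\varepsilon>0$ the rescaled constrained kinetic Cauchy problem $$ \partial_t f_\varepsilon(t,x)=\frac{\eta}{3\varepsilon^2}\Big(\int_\varepsilon^{\infty} f_\varepsilon(t,x_*)\,dx_*\Big)\Big[\mathbf 1_{x\ge 2\varepsilon}f_\varepsilon(t,x-\varepsilon)+\mathbf 1_{x\ge 0}f_\varepsilon(t,x+\varepsilon)-2\cdot\mathbf 1_{x\ge\varepsilon}f_\varepsilon(t,x)\Big],\qquad f_\varepsilon(0,\cdot)=f^{\mathrm{in}}, $$ has a unique solution $f_\varepsilon\in C([0,T];L^1(\mathbb{R}^+))$ (the time derivative being taken in $L^1(\mathbb{R}^+)$). Moreover, every sequence $\varepsilon_n>0$ with $\varepsilon_n\to 0$ has a subsequence along which the measures $f_{\varepsilon_n}(t,x)\,dt\,dx$ on $[0,T]\times\mathbb{R}^+$ converge weakly (tested against all bounded continuous functions) to the finite measure $$ \tilde f = f^+(t,x)\,dt\,dx+\Big(\|f^{\mathrm{in}}\|_{L^1(\mathbb{R}^+)}-\int_{\mathbb{R}^+}f^+(t,x)\,dx\Big)dt\otimes\delta_0(dx),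 $$ where $f^+\ge 0$ a.e., $\int_{\mathbb{R}^+} f^+(t,x)\,dx\le\|f^{\mathrm{in}}\|_{L^1(\mathbb{R}^+)}$ for a.e. $t\in[0,T]$, and $f^+$ is a very weak solution on $[0,T]\times\mathbb{R}^+$ of $$ \partial_t f^+=\frac{\eta}{3}\Big(\int_{\mathbb{R}^+}f^+(t,x_*)\,dx_*\Big)\partial_x^2f^+,\qquad f^+(t,0)=0,\qquad f^+(0,\cdot)=f^{\mathrm{in}}. $$ Very weak solution means: $f^+$ is measurable, $f^+\in L^1([0,T]\times\mathbb{R}^+)$, and $$ \int_0^T\!\!\int_{\mathbb{R}^+} f^+\partial_t\varphi\,dx\,dt+\frac{\eta}{3}\int_0^T\Big(\int_{\mathbb{R}^+}f^+(t,x_*)\,dx_*\Big)\Big(\int_{\mathbb{R}^+}f^+(t,x)\,\partial_x^2\varphi(t,x)\,dx\Big)dt+\int_{\mathbb{R}^+}f^{\mathrm{in}}(x)\varphi(0,x)\,dx=0 $$ (with an integrable integrand in the nonlinear term) for all $\varphi$ such that $\varphi,\partial_t\varphi,\partial_x\varphi,\partial_x^2\varphi$ exist and are continuous and bounded on $[0,T]\times\mathbb{R}^+$,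 with $\varphi(T,x)=0$ for all $x\in\mathbb{R}^+$ and $\varphi(t,0)=0$ for all $t\in[0,T]$; and the boundary value is attained in the sense that $\frac1\delta\int_0^\delta|f^+(t,x)|\,dx\to0$ as $\delta\to0^+$ for a.e. $t\in[0,T]$. -/

import Mathlib

open MeasureTheory Set Filter Topology
open scoped ENNReal BoundedContinuousFunction

namespace ConstrainedKinetic

/-- Lebesgue measure on the half-line `[0, ∞)`. -/
noncomputable abbrev halfLine : Measure ℝ := volume.restrict (Ici (0 : ℝ))

/-- The Banach space `L¹(ℝ⁺)`. -/
noncomputable abbrev L1 : Type := Lp ℝ 1 halfLine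

/-- The tail mass `β(g) = ∫_ε^∞ g`. -/
noncomputable def tailMass (ε : ℝ) (g : ℝ → ℝ) : ℝ := ∫ y in Ici ε, g y

/-- The jump operator
`(P g)(x) = 1_{x ≥ 2ε} g(x - ε) + 1_{x ≥ 0} g(x + ε) - 2 · 1_{x ≥ ε} g(x)`. -/
noncomputable def jump (ε : ℝ) (g : ℝ → ℝ) (x : ℝ) : ℝ :=
  (Ici (2 * ε)).indicator (fun x => g (x - ε)) x
    + (Ici (0 : ℝ)).indicator (fun x => g (x + ε)) x
    - (Ici ε).indicator (fun x => 2 * g x) x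

/-- The right-hand side `η / (3 ε²) · β(g) · P g` of the rescaled constrained kinetic equation. -/
noncomputable def collision (η ε : ℝ) (g : ℝ → ℝ) (x : ℝ) : ℝ :=
  η / (3 * ε ^ 2) * tailMass ε g * jump ε g x

/-- `u ∈ C([0,T]; L¹(ℝ⁺))` solves the rescaled constrained kinetic equation with initial datum
`fin`: the equation `∂ₜ u = collision η ε u` holds in `L¹(ℝ⁺)` at each time `t ∈ [0,T]`
(with one-sided time derivatives at the two end points). -/
structure IsKineticSolution (η T ε : ℝ) (fin : ℝ → ℝ) (u : ℝ → L1) : Prop where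
  continuousOn : ContinuousOn u (Icc 0 T)
  initial : (u 0 : ℝ → ℝ) =ᵐ[halfLine] fin
  equation : ∀ t ∈ Icc 0 T, ∃ v : L1,
    (v : ℝ → ℝ) =ᵐ[halfLine] collision η ε (u t) ∧ HasDerivWithinAt u v (Icc 0 T) t

/-- Test functions for the very weak formulation, with `φt = ∂ₜφ`, `φx = ∂ₓφ`, `φxx = ∂ₓ²φ`:
these functions are bounded and continuous on `[0,T] × [0,∞)`, the derivatives being one-sided
on the boundary, and `φ` vanishes at `t = T` and at `x = 0`. -/
structure IsTestFunction (T : ℝ) (φ φt φx φxx : ℝ → ℝ → ℝ) : Prop where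
  hasDeriv_t : ∀ t ∈ Icc 0 T, ∀ x ∈ Ici (0 : ℝ),
    HasDerivWithinAt (fun s => φ s x) (φt t x) (Icc 0 T) t
  hasDeriv_x : ∀ t ∈ Icc 0 T, ∀ x ∈ Ici (0 : ℝ),
    HasDerivWithinAt (φ t) (φx t x) (Ici 0) x
  hasDeriv_xx : ∀ t ∈ Icc 0 T, ∀ x ∈ Ici (0 : ℝ),
    HasDerivWithinAt (φx t) (φxx t x) (Ici 0) x
  continuousOn : ∀ g ∈ ({φ, φt, φx, φxx} : Set (ℝ → ℝ → ℝ)),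
    ContinuousOn (Function.uncurry g) (Icc 0 T ×ˢ Ici 0)
  bounded : ∀ g ∈ ({φ, φt, φx, φxx} : Set (ℝ → ℝ → ℝ)),
    ∃ C : ℝ, ∀ t ∈ Icc 0 T, ∀ x ∈ Ici (0 : ℝ), |g t x| ≤ C
  final : ∀ x ∈ Ici (0 : ℝ), φ T x = 0
  boundary : ∀ t ∈ Icc 0 T, φ t 0 = 0

/-- The total mass `∫_{ℝ⁺} f(t,x) dx` at time `t`. -/
noncomputable def mass (f : ℝ → ℝ → ℝ) (t : ℝ) : ℝ := ∫ x in Ici 0, f t x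

/-- Very weak solutions on `[0,T] × ℝ⁺` of `∂ₜ f = (η/3) (∫ f) ∂ₓ² f`, `f(t,0) = 0`,
`f(0,·) = fin`. The boundary value is recorded twice: test functions vanish at `x = 0`, and the
trace of `f(t,·)` at `0`, as a limit of averages, is zero for almost every `t`. -/
structure IsVeryWeakSolution (η T : ℝ) (fin : ℝ → ℝ) (f : ℝ → ℝ → ℝ) : Prop where
  measurable : Measurable (Function.uncurry f)
  integrable : IntegrableOn (Function.uncurry f) (Icc 0 T ×ˢ Ici 0)
  nonlinear_integrable : ∀ φ φt φx φxx, IsTestFunction T φ φt φx φxx →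
    IntegrableOn (fun t => mass f t * ∫ x in Ici 0, f t x * φxx t x) (Icc 0 T)
  equation : ∀ φ φt φx φxx, IsTestFunction T φ φt φx φxx →
    (∫ t in Icc 0 T, ∫ x in Ici 0, f t x * φt t x)
      + η / 3 * (∫ t in Icc 0 T, mass f t * ∫ x in Ici 0, f t x * φxx t x)
      + (∫ x in Ici 0, fin x * φ 0 x) = 0
  trace_zero : ∀ᵐ t ∂(volume.restrict (Icc 0 T)),
    Tendsto (fun δ : ℝ => δ⁻¹ * ∫ x in Ioc 0 δ, |f t x|) (𝓝[>] 0) (𝓝 0)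

/-- The measure `f(t,x) dt dx + (ρ - ∫ f(t,·)) dt ⊗ δ₀(dx)` on `[0,T] × ℝ⁺`, for `f ≥ 0` with
`∫ f(t,·) ≤ ρ`. -/
noncomputable def limitMeasure (T ρ : ℝ) (f : ℝ → ℝ → ℝ) : Measure (ℝ × ℝ) :=
  (volume.restrict (Icc 0 T ×ˢ Ici 0)).withDensity (fun p => ENNReal.ofReal (f p.1 p.2))
    + ((volume.restrict (Icc 0 T)).withDensity
        (fun t => ENNReal.ofReal (ρ - mass f t))).prod (Measure.dirac 0)

end ConstrainedKinetic

/-! The kinetic equation is a linear equation run at a solution-dependent speed. By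
`integral_jump_mul` the adjoint of the jump operator $P$ is the second difference on
$x\ge\varepsilon$ and zero on $[0,\varepsilon)$. So $P$ drives a walk with steps $\pm\varepsilon$,
each at rate one, absorbed in the cell $[0,\varepsilon)$. Hence
$f_\varepsilon(t)=e^{\tau(t)P}f^{\mathrm{in}}$, where $\tau$ solves the scalar ODE
$\tau'=\frac{\eta}{3\varepsilon^2}\beta$, with $\beta$ the mass on $[\varepsilon,\infty)$
(`exists_timeChange`). The right-hand side is locally Lipschitz in $L^1$, so the solution is unique
and every estimate on the explicit semigroup holds for every solution
(`IsKineticSolution.exists_profile`).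

Uniformly in $\varepsilon$, total mass is conserved, $f_\varepsilon\le M$ on $x\ge\varepsilon$
(`walkSum_le`), the tails at infinity are small (`IsKineticSolution.setIntegral_Ici_le`), and
$\beta$ decreases in time. The first two give weak $L^2$ compactness of the part of $f_\varepsilon$
on $x\ge\varepsilon$; tightness extends the convergence to bounded test functions.

The nonlinear term multiplies $\beta$ by a pairing with $f_\varepsilon$, and weak convergence alone
does not pass to the limit in such a product. Monotonicity in time rescues it: the integrals of
$\beta$ over intervals converge, so $\beta$ itself converges for almost every $t$
(`ae_tendsto_of_antitoneOn`), and the product is then a weak limit tested against bounded functions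
converging almost everywhere (`IsWeakLimit.tendsto`).

The remaining mass $\rho-\beta$ lies in $[0,\varepsilon)$ and becomes the Dirac part. It is
invisible in the weak formulation, because $\varphi$, hence $\partial_t\varphi$, vanishes at $x=0$.

The zero trace comes from a barrier: for the absorbed walk, linear functions are harmonic and the
cosine is an eigenfunction, so $f_\varepsilon\le M(x/L+e^{-ct\beta/L^2})$ on $\varepsilon\le x\le
L$. The bound survives the limit; letting $x\to0$ and then $L\to0$ gives the trace wherever the
limiting mass is positive, and elsewhere $f^+(t,\cdot)=0$. -/

namespace ConstrainedKinetic

/-! ### Shifts on the half-line, the jump operator and its adjoint. -/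

lemma measurePreserving_shift_Ici (a b : ℝ) :
    MeasurePreserving (fun x : ℝ => x + b) (volume.restrict (Ici a))
      (volume.restrict (Ici (a + b))) := by
  have h := (measurePreserving_add_right (volume : Measure ℝ) b).restrict_preimage_emb
    (MeasurableEquiv.addRight b).measurableEmbedding (Ici (a + b))
  convert h using 2
  ext x; simp

lemma measurableEmbedding_shift (b : ℝ) : MeasurableEmbedding (fun x : ℝ => x + b) :=
  (MeasurableEquiv.addRight b).measurableEmbedding

lemma integral_Ici_shift (a b : ℝ) (h : ℝ → ℝ) :
    ∫ x in Ici a, h (x + b) = ∫ x in Ici (a + b), h x :=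
  (measurePreserving_shift_Ici a b).integral_comp (measurableEmbedding_shift b) h

lemma integrableOn_Ici_shift (a b : ℝ) (h : ℝ → ℝ) :
    IntegrableOn (fun x => h (x + b)) (Ici a) ↔ IntegrableOn h (Ici (a + b)) :=
  (measurePreserving_shift_Ici a b).integrable_comp_emb (measurableEmbedding_shift b) (g := h)

lemma halfLine_restrict_Ici {a : ℝ} (ha : 0 ≤ a) :
    halfLine.restrict (Ici a) = volume.restrict (Ici a) := by
  rw [halfLine, Measure.restrict_restrict measurableSet_Ici]
  congr 1
  ext x; simp only [mem_inter_iff, mem_Ici]; constructor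
  · exact fun h => h.1
  · exact fun h => ⟨h, ha.trans h⟩

lemma setIntegral_halfLine_indicator {a : ℝ} (ha : 0 ≤ a) (h : ℝ → ℝ) :
    ∫ x in Ici 0, (Ici a).indicator h x = ∫ x in Ici a, h x := by
  rw [integral_indicator measurableSet_Ici]
  exact congrArg (fun m => ∫ x, h x ∂m) (halfLine_restrict_Ici ha)

lemma integrable_halfLine_indicator {a : ℝ} (ha : 0 ≤ a) {h : ℝ → ℝ} :
    Integrable ((Ici a).indicator h) halfLine ↔ IntegrableOn h (Ici a) := by
  rw [integrable_indicator_iff measurableSet_Ici, IntegrableOn, halfLine_restrict_Ici ha]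
  rfl

lemma integrableOn_mul_shift {g φ : ℝ → ℝ} {a b C : ℝ} (ha : 0 ≤ a) (hab : 0 ≤ a + b)
    (hg : Integrable g halfLine)
    (hφ : AEStronglyMeasurable φ halfLine) (hC : ∀ x ∈ Ici (0 : ℝ), |φ x| ≤ C) :
    IntegrableOn (fun x => g x * φ (x + b)) (Ici a) := by
  have hg' : IntegrableOn g (Ici a) := IntegrableOn.mono_set hg (Ici_subset_Ici.2 ha)
  have hm : AEStronglyMeasurable (fun x => φ (x + b)) (volume.restrict (Ici a)) := by
    have : AEStronglyMeasurable φ (volume.restrict (Ici (a + b))) :=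
      hφ.mono_measure (Measure.restrict_mono (Ici_subset_Ici.2 hab) le_rfl)
    exact this.comp_measurePreserving (measurePreserving_shift_Ici a b)
  refine Integrable.mul_bdd (c := C) hg' hm ?_
  filter_upwards [ae_restrict_mem measurableSet_Ici] with x hx
  exact hC _ (by simp only [mem_Ici] at hx ⊢; linarith)

section jump
variable {ε : ℝ} {g φ : ℝ → ℝ} {C : ℝ}

lemma jump_mul_eq (x : ℝ) (hx : 0 ≤ x) : jump ε g x * φ x =
    (Ici (2 * ε)).indicator (fun x => g (x - ε) * φ x) x + g (x + ε) * φ x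
      - 2 * (Ici ε).indicator (fun x => g x * φ x) x := by
  unfold jump
  have h0 : x ∈ Ici (0 : ℝ) := hx
  simp only [indicator, h0, if_true]
  split_ifs <;> ring

lemma integrable_jump_terms (hε : 0 < ε) (hg : Integrable g halfLine)
    (hφ : AEStronglyMeasurable φ halfLine) (hC : ∀ x ∈ Ici (0 : ℝ), |φ x| ≤ C) :
    Integrable ((Ici (2 * ε)).indicator (fun x => g (x - ε) * φ x)) halfLine ∧
    Integrable (fun x => g (x + ε) * φ x) halfLine ∧
    Integrable ((Ici ε).indicator (fun x => g x * φ x)) halfLine := by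
  refine ⟨?_, ?_, ?_⟩
  · rw [integrable_halfLine_indicator (by linarith)]
    have := (integrableOn_Ici_shift (2 * ε) (-ε) (fun x => g x * φ (x + ε))).2
      (integrableOn_mul_shift (by linarith) (by linarith) hg hφ hC)
    refine this.congr_fun (fun x _ => ?_) measurableSet_Ici
    simp [sub_eq_add_neg]
  · have := (integrableOn_Ici_shift 0 ε (fun x => g x * φ (x + (-ε)))).2
      (integrableOn_mul_shift (by linarith) (by linarith) hg hφ hC)
    refine this.congr_fun (fun x _ => ?_) measurableSet_Ici
    simp
  · rw [integrable_halfLine_indicator hε.le]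
    have := integrableOn_mul_shift (b := 0) hε.le (by linarith) hg hφ hC
    simpa using this

lemma integrable_jump_mul (hε : 0 < ε) (hg : Integrable g halfLine)
    (hφ : AEStronglyMeasurable φ halfLine) (hC : ∀ x ∈ Ici (0 : ℝ), |φ x| ≤ C) :
    Integrable (fun x => jump ε g x * φ x) halfLine := by
  obtain ⟨h1, h2, h3⟩ := integrable_jump_terms hε hg hφ hC
  refine ((h1.add h2).sub (h3.const_mul 2)).congr ?_
  filter_upwards [ae_restrict_mem measurableSet_Ici] with x hx
  simp only [Pi.add_apply, Pi.sub_apply]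
  rw [jump_mul_eq x hx]

/-- The adjoint of the jump operator is the second difference. -/
lemma integral_jump_mul (hε : 0 < ε) (hg : Integrable g halfLine)
    (hφ : AEStronglyMeasurable φ halfLine) (hC : ∀ x ∈ Ici (0 : ℝ), |φ x| ≤ C) :
    ∫ x in Ici 0, jump ε g x * φ x
      = ∫ x in Ici ε, g x * (φ (x + ε) + φ (x - ε) - 2 * φ x) := by
  obtain ⟨h1, h2, h3⟩ := integrable_jump_terms hε hg hφ hC
  have e1 : ∫ x in Ici 0, jump ε g x * φ x =
      ∫ x in Ici 0, ((Ici (2 * ε)).indicator (fun x => g (x - ε) * φ x) x + g (x + ε) * φ x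
      - 2 * (Ici ε).indicator (fun x => g x * φ x) x) :=
    setIntegral_congr_fun measurableSet_Ici fun x hx => jump_mul_eq x hx
  have a1 := integrableOn_mul_shift (b := ε) hε.le (by linarith) hg hφ hC
  have a2 := integrableOn_mul_shift (b := -ε) hε.le (by linarith) hg hφ hC
  have a3 := integrableOn_mul_shift (b := 0) hε.le (by linarith) hg hφ hC
  have e2 : ∫ x in Ici ε, g x * (φ (x + ε) + φ (x - ε) - 2 * φ x) =
      ∫ x in Ici ε, (g x * φ (x + ε) + g x * φ (x + (-ε)) - 2 * (g x * φ (x + 0))) := by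
    congr 1; ext x; simp only [add_zero, sub_eq_add_neg]; ring
  have s1 : ∫ x in Ici 0, (Ici (2 * ε)).indicator (fun x => g (x - ε) * φ x) x
      = ∫ x in Ici ε, g x * φ (x + ε) := by
    rw [setIntegral_halfLine_indicator (by linarith)]
    have := integral_Ici_shift (2 * ε) (-ε) (fun x => g x * φ (x + ε))
    rw [show 2 * ε + -ε = ε by ring] at this
    rw [← this]; congr 1; ext x; simp [sub_eq_add_neg]
  have s2 : ∫ x in Ici 0, g (x + ε) * φ x = ∫ x in Ici ε, g x * φ (x + (-ε)) := by
    have := integral_Ici_shift 0 ε (fun x => g x * φ (x + (-ε)))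
    rw [zero_add] at this
    rw [← this]; congr 1; ext x; simp
  have s3 : ∫ x in Ici 0, (Ici ε).indicator (fun x => g x * φ x) x
      = ∫ x in Ici ε, g x * φ (x + 0) := by
    rw [setIntegral_halfLine_indicator hε.le]; simp
  have l := (integral_sub (h1.add h2) (h3.const_mul 2)).trans
    (congrArg₂ (· - ·) (integral_add h1 h2) (integral_const_mul 2 _))
  have r := (integral_sub (a1.add a2) (a3.const_mul 2)).trans
    (congrArg₂ (· - ·) (integral_add a1 a2) (integral_const_mul 2 _))
  rw [e1, e2]
  refine l.trans (Eq.trans ?_ r.symm)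
  change (_ + _ - 2 * _ : ℝ) = _ + _ - 2 * _
  rw [s1, s2, s3]

lemma integrable_jump (hε : 0 < ε) (hg : Integrable g halfLine) :
    Integrable (jump ε g) halfLine := by
  simpa using integrable_jump_mul (φ := fun _ => 1) (C := 1) hε hg
    aestronglyMeasurable_const (by simp)

lemma integral_jump (hε : 0 < ε) (hg : Integrable g halfLine) :
    ∫ x in Ici 0, jump ε g x = 0 := by
  have := integral_jump_mul (φ := fun _ => 1) (C := 1) hε hg aestronglyMeasurable_const (by simp)
  simpa [show (1 : ℝ) + 1 - 2 = 0 by norm_num] using this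

/-- Translations preserve null sets, and the indicators keep every evaluation point inside the
half-line. This makes the operator well defined on $L^1$ classes. -/
lemma jump_congr_ae (hε : 0 < ε) {h : ℝ → ℝ} (hgh : g =ᵐ[halfLine] h) :
    jump ε g =ᵐ[halfLine] jump ε h := by
  have e : ∀ᵐ y : ℝ, y ∈ Ici (0 : ℝ) → g y = h y := (ae_restrict_iff' measurableSet_Ici).1 hgh
  have e1 := (measurePreserving_add_right (volume : Measure ℝ) (-ε)).quasiMeasurePreserving.ae e
  have e2 := (measurePreserving_add_right (volume : Measure ℝ) ε).quasiMeasurePreserving.ae e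
  refine (ae_restrict_iff' measurableSet_Ici).2 ?_
  filter_upwards [e, e1, e2] with x h0 h1 h2 hx
  have hx' : (0 : ℝ) ≤ x := hx
  have k2 : g (x + ε) = h (x + ε) := h2 (by simp only [mem_Ici]; linarith)
  unfold jump
  simp only [indicator, k2, h0 hx]
  split_ifs with c1
  all_goals first
    | rfl
    | (have k1 : g (x - ε) = h (x - ε) := by
        simpa [sub_eq_add_neg] using h1 (by simp only [mem_Ici] at c1 ⊢; linarith)
       rw [k1])

lemma jump_add (g h : ℝ → ℝ) : jump ε (fun x => g x + h x) = fun x => jump ε g x + jump ε h x := by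
  ext x; unfold jump; simp only [indicator]; split_ifs <;> ring

lemma jump_smul (c : ℝ) (g : ℝ → ℝ) : jump ε (fun x => c * g x) = fun x => c * jump ε g x := by
  ext x; unfold jump; simp only [indicator]; split_ifs <;> ring

/-- The first term on the right has integral zero, so integrating gives the operator bound 4 on
$L^1$. -/
lemma abs_jump_le (x : ℝ) (hx : 0 ≤ x) (hε : 0 < ε) :
    |jump ε g x| ≤ jump ε (fun y => |g y|) x + 4 * |g x| := by
  unfold jump
  have h0 : x ∈ Ici (0 : ℝ) := hx
  simp only [indicator, h0, if_true, mem_Ici]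
  have a1 := abs_nonneg (g (x - ε)); have a2 := abs_nonneg (g (x + ε)); have a3 := abs_nonneg (g x)
  split_ifs <;> rw [abs_le] <;> constructor <;>
    linarith [neg_abs_le (g (x - ε)), le_abs_self (g (x - ε)), neg_abs_le (g (x + ε)),
      le_abs_self (g (x + ε)), neg_abs_le (g x), le_abs_self (g x)]

end jump

/-! ### The jump operator and bounded functionals on $L^1$. -/

lemma exists_jumpL {ε : ℝ} (hε : 0 < ε) :
    ∃ J : L1 →L[ℝ] L1, ∀ g : L1, (J g : ℝ → ℝ) =ᵐ[halfLine] jump ε g := by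
  have hi : ∀ g : L1, Integrable (jump ε g) halfLine := fun g =>
    integrable_jump hε (L1.integrable_coeFn g)
  let J₀ : L1 →ₗ[ℝ] L1 :=
    { toFun := fun g => (hi g).toL1
      map_add' := fun g h => by
        refine Lp.ext ?_
        filter_upwards [(hi (g + h)).coeFn_toL1, (hi g).coeFn_toL1, (hi h).coeFn_toL1,
          Lp.coeFn_add ((hi g).toL1) ((hi h).toL1), jump_congr_ae hε (Lp.coeFn_add g h)]
          with x h1 h2 h3 h4 h5
        rw [h1, h4, Pi.add_apply, h2, h3, h5]
        exact congrFun (jump_add (g : ℝ → ℝ) h) x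
      map_smul' := fun c g => by
        refine Lp.ext ?_
        filter_upwards [(hi (c • g)).coeFn_toL1, (hi g).coeFn_toL1,
          Lp.coeFn_smul c ((hi g).toL1), jump_congr_ae hε (Lp.coeFn_smul c g)]
          with x h1 h2 h4 h5
        rw [h1, RingHom.id_apply, h4, Pi.smul_apply, h2, h5]
        exact congrFun (jump_smul c (g : ℝ → ℝ)) x }
  refine ⟨J₀.mkContinuous 4 fun g => ?_, fun g => (hi g).coeFn_toL1⟩
  have hg := L1.integrable_coeFn g
  change ‖(hi g).toL1‖ ≤ _
  rw [L1.norm_eq_integral_norm, L1.norm_eq_integral_norm g]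
  calc ∫ x, ‖((hi g).toL1 : ℝ → ℝ) x‖ ∂halfLine = ∫ x, |jump ε g x| ∂halfLine := by
        refine integral_congr_ae ?_
        filter_upwards [(hi g).coeFn_toL1] with x hx
        rw [hx, Real.norm_eq_abs]
    _ ≤ ∫ x, (jump ε (fun y => |(g : ℝ → ℝ) y|) x + 4 * |(g : ℝ → ℝ) x|) ∂halfLine := by
        refine integral_mono_ae (hi g).abs ((integrable_jump hε hg.abs).add (hg.abs.const_mul 4)) ?_
        filter_upwards [ae_restrict_mem measurableSet_Ici] with x hx
        exact abs_jump_le x hx hε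
    _ = 4 * ∫ x, ‖(g : ℝ → ℝ) x‖ ∂halfLine := by
        rw [integral_add (integrable_jump hε hg.abs) (hg.abs.const_mul 4), integral_jump hε hg.abs,
          integral_const_mul, zero_add]
        rfl

/-- Integration against a bounded function is a bounded functional on `L¹(ℝ⁺)`. -/
lemma exists_pairingL {φ : ℝ → ℝ} {C : ℝ} (hφ : AEStronglyMeasurable φ halfLine)
    (hC : ∀ x ∈ Ici (0 : ℝ), |φ x| ≤ C) :
    ∃ ℓ : L1 →L[ℝ] ℝ, (∀ g : L1, ℓ g = ∫ x in Ici 0, g x * φ x) ∧ ∀ g : L1, |ℓ g| ≤ C * ‖g‖ := by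
  have hb : ∀ᵐ x ∂halfLine, ‖φ x‖ ≤ C := by
    filter_upwards [ae_restrict_mem measurableSet_Ici] with x hx using hC x hx
  have hi : ∀ g : L1, Integrable (fun x => g x * φ x) halfLine := fun g =>
    (L1.integrable_coeFn g).mul_bdd hφ hb
  let ℓ₀ : L1 →ₗ[ℝ] ℝ :=
    { toFun := fun g => ∫ x in Ici 0, g x * φ x
      map_add' := fun g h => by
        rw [← integral_add (hi g) (hi h)]
        refine integral_congr_ae ?_
        filter_upwards [Lp.coeFn_add g h] with x hx
        rw [hx, Pi.add_apply]; ring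
      map_smul' := fun c g => by
        rw [RingHom.id_apply, smul_eq_mul, ← integral_const_mul]
        refine integral_congr_ae ?_
        filter_upwards [Lp.coeFn_smul c g] with x hx
        rw [hx, Pi.smul_apply, smul_eq_mul]; ring }
  have hbd : ∀ g : L1, ‖ℓ₀ g‖ ≤ C * ‖g‖ := fun g => by
    rw [L1.norm_eq_integral_norm, ← integral_const_mul]
    refine norm_integral_le_of_norm_le ((L1.integrable_coeFn g).norm.const_mul C) ?_
    filter_upwards [hb] with x hx
    rw [norm_mul, mul_comm]
    exact mul_le_mul_of_nonneg_right hx (norm_nonneg _)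
  exact ⟨ℓ₀.mkContinuous C hbd, fun g => rfl, hbd⟩

/-! ### The absorbed walk: positivity, uniform bound and barrier. -/

/-- The iterates `(P + 2)ᵏ h` of the nonnegative part of the jump operator. -/
noncomputable def walk (ε : ℝ) (h : ℝ → ℝ) : ℕ → ℝ → ℝ
  | 0 => h
  | k + 1 => fun x => jump ε (walk ε h k) x + 2 * walk ε h k x

/-- The Poisson mixture `e^{-2τ} ∑ τᵏ / k! (P + 2)ᵏ h`. -/
noncomputable def walkSum (ε : ℝ) (h : ℝ → ℝ) (τ x : ℝ) : ℝ :=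
  Real.exp (-2 * τ) * ∑' k : ℕ, (τ ^ k / k.factorial) * walk ε h k x

section walk
variable {ε M : ℝ} {h : ℝ → ℝ}

lemma measurable_jump {g : ℝ → ℝ} (hg : Measurable g) : Measurable (jump ε g) := by
  unfold jump
  refine ((Measurable.indicator ?_ measurableSet_Ici).add
    (Measurable.indicator ?_ measurableSet_Ici)).sub (Measurable.indicator ?_ measurableSet_Ici)
  · exact hg.comp (measurable_id.sub_const ε)
  · exact hg.comp (measurable_id.add_const ε)
  · exact hg.const_mul 2

lemma measurable_walk (hm : Measurable h) (k : ℕ) : Measurable (walk ε h k) := by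
  induction k with
  | zero => exact hm
  | succ k ih => exact (measurable_jump ih).add (ih.const_mul 2)

lemma walk_nonneg (h0 : ∀ x, 0 ≤ h x) (k : ℕ) (x : ℝ) : 0 ≤ walk ε h k x := by
  induction k generalizing x with
  | zero => exact h0 x
  | succ k ih =>
    simp only [walk, jump, indicator]
    have a1 := ih (x - ε); have a2 := ih (x + ε); have a3 := ih x
    split_ifs <;> linarith

/-- A crude bound that also covers the absorbing cell, where mass accumulates; it serves only for
summability of the Poisson series. -/
lemma walk_le_four_pow (h0 : ∀ x, 0 ≤ h x) (hM : ∀ x, h x ≤ M) (k : ℕ) (x : ℝ) :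
    walk ε h k x ≤ 4 ^ k * M := by
  induction k generalizing x with
  | zero => simpa [walk] using hM x
  | succ k ih =>
    simp only [walk, jump, indicator, pow_succ]
    have a1 := ih (x - ε); have a2 := ih (x + ε); have a3 := ih x
    have b1 := walk_nonneg (ε := ε) h0 k (x - ε)
    have b2 := walk_nonneg (ε := ε) h0 k (x + ε)
    have b3 := walk_nonneg (ε := ε) h0 k x
    split_ifs <;> linarith

/-- On $x\ge\varepsilon$ the recursion never reads a value from $[0,\varepsilon)$: there the
iterates are those of a walk killed at the origin, and nothing returns from the absorbing cell. -/
lemma walk_succ_of_le (hε : 0 < ε) (k : ℕ) {x : ℝ} (hx : ε ≤ x) : walk ε h (k + 1) x =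
    (if 2 * ε ≤ x then walk ε h k (x - ε) else 0) + walk ε h k (x + ε) := by
  simp only [walk, jump, indicator, mem_Ici, hx, if_true, hε.le.trans hx]
  split_ifs <;> ring

lemma walk_le (hε : 0 < ε) (h0 : ∀ x, 0 ≤ h x) (hM : ∀ x, h x ≤ M) (k : ℕ) {x : ℝ} (hx : ε ≤ x) :
    walk ε h k x ≤ 2 ^ k * M := by
  induction k generalizing x with
  | zero => simpa [walk] using hM x
  | succ k ih =>
    rw [walk_succ_of_le hε k hx, pow_succ]
    have a2 := ih (x := x + ε) (by linarith)
    have b2 := walk_nonneg (ε := ε) h0 k (x + ε)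
    have hM0 := walk_nonneg (ε := ε) h0 k x
    have a3 := ih hx
    split_ifs with c
    · have a1 := ih (x := x - ε) (by linarith)
      linarith
    · linarith

/-- The linear-plus-cosine barrier is preserved by the walk killed at the origin. -/
lemma walk_le_barrier {L : ℝ} (hε : 0 < ε) (hL : 0 < L) (hεL : ε ≤ L / 2) (hM0 : 0 ≤ M)
    (h0 : ∀ x, 0 ≤ h x) (hM : ∀ x, h x ≤ M) (k : ℕ) {x : ℝ} (hx : ε ≤ x) (hxL : x ≤ L) :
    walk ε h k x ≤ 2 ^ k * (M * (x / L + Real.cos (ε / L) ^ k * Real.cos (x / L))) := by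
  have hεL' : ε / L ≤ 1 / 2 := by rw [div_le_iff₀ hL]; linarith
  have hεL0 : 0 < ε / L := div_pos hε hL
  have hpi := Real.pi_gt_three
  have hc0 : 0 ≤ Real.cos (ε / L) := Real.cos_nonneg_of_neg_pi_div_two_le_of_le
    (by linarith) (by linarith)
  -- One step beyond $L$ is allowed, since $\varepsilon\le L/2$ keeps the argument below
  -- $3/2<\pi/2$.
  have hcos : ∀ y, 0 ≤ y → y ≤ L + ε → 0 ≤ Real.cos (y / L) := fun y hy hyL => by
    have h1 : 0 ≤ y / L := div_nonneg hy hL.le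
    have h2 : y / L ≤ 3 / 2 := by rw [div_le_iff₀ hL]; linarith
    exact Real.cos_nonneg_of_neg_pi_div_two_le_of_le (by linarith) (by linarith)
  induction k generalizing x with
  | zero =>
    have h1 : 0 ≤ x / L := div_nonneg (by linarith) hL.le
    have h2 : x / L ≤ 1 := (div_le_one hL).2 hxL
    have h3 := Real.one_sub_sq_div_two_le_cos (x := x / L)
    -- With $y=x/L\in[0,1]$: $y+\cos y\ge 1+y-y^2/2\ge1$.
    have h4 : 1 ≤ x / L + Real.cos (x / L) := by nlinarith
    have := hM x
    simp only [walk, pow_zero, one_mul]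
    nlinarith
  | succ k ih =>
    set a := Real.cos (ε / L) ^ k with ha
    have ha0 : 0 ≤ a := pow_nonneg hc0 k
    set W : ℝ → ℝ := fun y => 2 ^ k * (M * (y / L + a * Real.cos (y / L))) with hW
    have hW0 : ∀ y, 0 ≤ y → y ≤ L + ε → 0 ≤ W y := fun y hy hyL => by
      have := hcos y hy hyL
      have : 0 ≤ y / L := div_nonneg hy hL.le
      positivity
    -- The sum of the two neighbouring values doubles a linear function and multiplies the cosine by
    -- $2\cos(\varepsilon/L)$.
    have hsum : 2 ^ (k + 1) * (M * (x / L + Real.cos (ε / L) ^ (k + 1) * Real.cos (x / L)))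
        = W (x - ε) + W (x + ε) := by
      simp only [hW, sub_div, add_div, Real.cos_sub, Real.cos_add]
      rw [pow_succ, pow_succ, ← ha]; ring
    rw [walk_succ_of_le hε k hx, hsum]
    have hright : walk ε h k (x + ε) ≤ W (x + ε) := by
      by_cases hc : x + ε ≤ L
      · exact ih (by linarith) hc
      · push Not at hc
        -- Past $L$ the linear part alone is at least 1, so the uniform bound already lies below the
        -- barrier.
        refine (walk_le hε h0 hM k (by linarith)).trans ?_
        have h1 : 1 ≤ (x + ε) / L := (one_le_div hL).2 hc.le
        have h2 := hcos (x + ε) (by linarith) (by linarith)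
        have h3 : 0 ≤ a * Real.cos ((x + ε) / L) := mul_nonneg ha0 h2
        simp only [hW]
        gcongr
        nlinarith
    have hleft : (if 2 * ε ≤ x then walk ε h k (x - ε) else 0) ≤ W (x - ε) := by
      split_ifs with c
      · exact ih (by linarith) (by linarith)
      · exact hW0 _ (by linarith) (by linarith)
    linarith

lemma summable_walk (h0 : ∀ x, 0 ≤ h x) (hM : ∀ x, h x ≤ M) (τ x : ℝ) :
    Summable fun k : ℕ => (τ ^ k / k.factorial) * walk ε h k x := by
  refine Summable.of_norm_bounded
    (g := fun k : ℕ => ((4 * |τ|) ^ k / k.factorial) * M)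
    ((Real.summable_pow_div_factorial (4 * |τ|)).mul_right M) fun k => ?_
  rw [norm_mul, norm_div, norm_pow, Real.norm_natCast, Real.norm_eq_abs, Real.norm_eq_abs,
    abs_of_nonneg (walk_nonneg h0 k x), mul_pow]
  calc |τ| ^ k / k.factorial * walk ε h k x ≤ |τ| ^ k / k.factorial * (4 ^ k * M) := by
        gcongr; exact walk_le_four_pow h0 hM k x
    _ = _ := by ring

lemma measurable_walkSum (hm : Measurable h) :
    Measurable (fun p : ℝ × ℝ => walkSum ε h p.1 p.2) := by
  unfold walkSum
  refine Measurable.mul (by fun_prop) (Measurable.tsum fun k => ?_)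
  exact (by fun_prop : Measurable fun p : ℝ × ℝ => p.1 ^ k / (k.factorial : ℝ)).mul
    ((measurable_walk hm k).comp measurable_snd)

lemma walkSum_nonneg (h0 : ∀ x, 0 ≤ h x) {τ : ℝ} (hτ : 0 ≤ τ) (x : ℝ) : 0 ≤ walkSum ε h τ x :=
  mul_nonneg (Real.exp_pos _).le (tsum_nonneg fun k =>
    mul_nonneg (by positivity) (walk_nonneg h0 k x))

lemma tsum_pow_div_factorial (τ : ℝ) : ∑' k : ℕ, τ ^ k / k.factorial = Real.exp τ := by
  rw [Real.exp_eq_exp_ℝ, NormedSpace.exp_eq_tsum_div]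

/-- The factor $2^k$ of `walk_le` turns the series into $e^{2\tau}$, which the prefactor cancels. -/
lemma walkSum_le (hε : 0 < ε) (h0 : ∀ x, 0 ≤ h x) (hM : ∀ x, h x ≤ M) {τ x : ℝ} (hτ : 0 ≤ τ)
    (hx : ε ≤ x) : walkSum ε h τ x ≤ M := by
  have hs : ∑' k : ℕ, (τ ^ k / k.factorial) * walk ε h k x
      ≤ ∑' k : ℕ, ((2 * τ) ^ k / k.factorial) * M := by
    refine Summable.tsum_le_tsum (fun k => ?_) (summable_walk h0 hM τ x)
      ((Real.summable_pow_div_factorial (2 * τ)).mul_right M)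
    calc τ ^ k / k.factorial * walk ε h k x ≤ τ ^ k / k.factorial * (2 ^ k * M) := by
          gcongr; exact walk_le hε h0 hM k hx
      _ = _ := by rw [mul_pow]; ring
  rw [tsum_mul_right, tsum_pow_div_factorial] at hs
  calc walkSum ε h τ x ≤ Real.exp (-2 * τ) * (Real.exp (2 * τ) * M) := by
        unfold walkSum; gcongr
    _ = M := by rw [← mul_assoc, ← Real.exp_add]; simp

/-- The powers $\cos(\varepsilon/L)^k$ are averaged over a Poisson law of mean $2\tau$, whose
generating function produces the exponential. -/
lemma walkSum_le_barrier {L : ℝ} (hε : 0 < ε) (hL : 0 < L) (hεL : ε ≤ L / 2) (hM0 : 0 ≤ M)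
    (h0 : ∀ x, 0 ≤ h x) (hM : ∀ x, h x ≤ M) {τ x : ℝ} (hτ : 0 ≤ τ) (hx : ε ≤ x) (hxL : x ≤ L) :
    walkSum ε h τ x ≤ M * (x / L + Real.exp (-(2 * τ * (1 - Real.cos (ε / L))))) := by
  set c := Real.cos (ε / L) with hc
  have hs : ∑' k : ℕ, (τ ^ k / k.factorial) * walk ε h k x
      ≤ ∑' k : ℕ, (((2 * τ) ^ k / k.factorial) * (M * (x / L))
        + ((2 * τ * c) ^ k / k.factorial) * (M * Real.cos (x / L))) := by
    refine Summable.tsum_le_tsum (fun k => ?_) (summable_walk h0 hM τ x)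
      (((Real.summable_pow_div_factorial (2 * τ)).mul_right _).add
        ((Real.summable_pow_div_factorial (2 * τ * c)).mul_right _))
    calc τ ^ k / k.factorial * walk ε h k x ≤ τ ^ k / k.factorial *
          (2 ^ k * (M * (x / L + c ^ k * Real.cos (x / L)))) := by
          gcongr; exact walk_le_barrier hε hL hεL hM0 h0 hM k hx hxL
      _ = _ := by rw [mul_pow, mul_pow]; ring
  rw [((Real.summable_pow_div_factorial (2 * τ)).mul_right _).tsum_add
        ((Real.summable_pow_div_factorial (2 * τ * c)).mul_right _),
    tsum_mul_right, tsum_mul_right, tsum_pow_div_factorial, tsum_pow_div_factorial] at hs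
  calc walkSum ε h τ x ≤ Real.exp (-2 * τ) * (Real.exp (2 * τ) * (M * (x / L))
        + Real.exp (2 * τ * c) * (M * 1)) := by
        unfold walkSum
        refine mul_le_mul_of_nonneg_left (hs.trans ?_) (Real.exp_pos _).le
        gcongr
        exact Real.cos_le_one _
    _ = (Real.exp (-2 * τ) * Real.exp (2 * τ)) * (M * (x / L))
        + (Real.exp (-2 * τ) * Real.exp (2 * τ * c)) * M := by ring
    _ = _ := by
      rw [← Real.exp_add, ← Real.exp_add, show -2 * τ + 2 * τ = 0 by ring, Real.exp_zero,
        show -2 * τ + 2 * τ * c = -(2 * τ * (1 - c)) by ring]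
      ring

/-! ### The linear semigroup and its pointwise representation. -/

/-- The semigroup generated by the jump operator, in terms of `N = J + 2`. -/
noncomputable def semigroup (J : L1 →L[ℝ] L1) (τ : ℝ) : L1 →L[ℝ] L1 :=
  Real.exp (-2 * τ) • NormedSpace.exp (τ • (J + (2 : ℝ) • ContinuousLinearMap.id ℝ L1))

lemma hasDerivAt_semigroup (J : L1 →L[ℝ] L1) (F : L1) (τ : ℝ) :
    HasDerivAt (fun s => semigroup J s F) (J (semigroup J τ F)) τ := by
  set N := J + (2 : ℝ) • ContinuousLinearMap.id ℝ L1 with hN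
  have h1 : HasDerivAt (fun s : ℝ => Real.exp (-2 * s)) (-2 * Real.exp (-2 * τ)) τ := by
    have := ((hasDerivAt_id τ).const_mul (-2 : ℝ)).exp
    simpa [mul_comm] using this
  have h2 := hasDerivAt_exp_smul_const' (𝕂 := ℝ) N τ
  have h3 := (h1.smul h2).clm_apply (hasDerivAt_const τ F)
  refine h3.congr_deriv ?_
  simp only [semigroup, ← hN]
  have hJ : J = N - (2 : ℝ) • ContinuousLinearMap.id ℝ L1 := by rw [hN]; abel
  rw [hJ]
  simp only [mul_apply_eq_comp, add_apply, map_zero, add_zero, sub_apply,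
    ContinuousLinearMap.coe_id', id_eq, map_smul, smul_apply]
  module

lemma semigroup_zero (J : L1 →L[ℝ] L1) (F : L1) : semigroup J 0 F = F := by
  simp [semigroup, NormedSpace.exp_zero]

/-- The exponential series is absolutely summable in $L^1$, so it also converges almost everywhere
to the same sum. This transfers the pointwise bounds to the semigroup and supplies a version jointly
measurable in $(\tau,x)$. -/
lemma semigroup_ae_eq_walkSum (hε : 0 < ε) {J : L1 →L[ℝ] L1}
    (hJ : ∀ g : L1, (J g : ℝ → ℝ) =ᵐ[halfLine] jump ε g) {F : L1}
    (hF : (F : ℝ → ℝ) =ᵐ[halfLine] h) (τ : ℝ) :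
    (semigroup J τ F : ℝ → ℝ) =ᵐ[halfLine] walkSum ε h τ := by
  set N := J + (2 : ℝ) • ContinuousLinearMap.id ℝ L1 with hN
  have hpow : ∀ k : ℕ, ((N ^ k) F : ℝ → ℝ) =ᵐ[halfLine] walk ε h k := by
    intro k
    induction k with
    | zero => simpa [walk] using hF
    | succ k ih =>
      have e : (N ^ (k + 1)) F = J ((N ^ k) F) + (2 : ℝ) • (N ^ k) F := by
        rw [pow_succ', mul_apply_eq_comp]; simp [hN]
      rw [e]
      filter_upwards [Lp.coeFn_add (J ((N ^ k) F)) ((2 : ℝ) • (N ^ k) F),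
        Lp.coeFn_smul (2 : ℝ) ((N ^ k) F), hJ ((N ^ k) F), jump_congr_ae hε ih, ih]
        with x h1 h2 h3 h4 h5
      rw [h1, Pi.add_apply, h2, h3, h4, Pi.smul_apply, h5]
      rfl
  have hsum : HasSum (fun k : ℕ => (τ ^ k / k.factorial) • (N ^ k) F)
      (NormedSpace.exp (τ • N) F) := by
    have h1 := NormedSpace.exp_series_hasSum_exp' (𝕂 := ℝ) (τ • N)
    have h2 := h1.mapL (ContinuousLinearMap.apply ℝ L1 F)
    convert h2 using 2 with k
    · simp only [ContinuousLinearMap.apply_apply, smul_apply, smul_pow, smul_smul]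
      congr 1; ring
    · rfl
  have hnorm : Summable fun k : ℕ => ‖(τ ^ k / k.factorial) • (N ^ k) F‖ := by
    refine Summable.of_nonneg_of_le (fun _ => norm_nonneg _) (fun k => ?_)
      ((Real.summable_pow_div_factorial (|τ| * ‖N‖)).mul_right ‖F‖)
    rw [norm_smul, norm_div, norm_pow, Real.norm_natCast, Real.norm_eq_abs]
    have : ‖(N ^ k) F‖ ≤ ‖N‖ ^ k * ‖F‖ := by
      clear hsum hpow
      induction k with
      | zero => simp
      | succ k ih =>
        rw [pow_succ', mul_apply_eq_comp, pow_succ', mul_assoc]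
        exact (N.le_opNorm _).trans (by gcongr)
    calc |τ| ^ k / k.factorial * ‖(N ^ k) F‖ ≤ |τ| ^ k / k.factorial * (‖N‖ ^ k * ‖F‖) := by gcongr
      _ = _ := by rw [mul_pow]; ring
  have hpt := Lp.hasSum_coeFn_tsum (f := fun k : ℕ => (τ ^ k / k.factorial) • (N ^ k) F)
    (tsum_enorm_ne_top_iff_summable_norm.2 hnorm)
  rw [hsum.tsum_eq] at hpt
  have hsm : ∀ᵐ x ∂halfLine, ∀ k : ℕ, ((τ ^ k / k.factorial) • (N ^ k) F : L1) x
      = (τ ^ k / k.factorial) * walk ε h k x := by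
    rw [ae_all_iff]
    intro k
    filter_upwards [Lp.coeFn_smul (τ ^ k / k.factorial : ℝ) ((N ^ k) F), hpow k] with x h1 h2
    rw [h1, Pi.smul_apply, h2, smul_eq_mul]
  have e : semigroup J τ F = Real.exp (-2 * τ) • (NormedSpace.exp (τ • N) F) := by
    simp [semigroup, hN]
  rw [e]
  filter_upwards [hpt, hsm, Lp.coeFn_smul (Real.exp (-2 * τ)) (NormedSpace.exp (τ • N) F)]
    with x h1 h2 h3
  rw [h3, Pi.smul_apply, smul_eq_mul, walkSum, ← h1.tsum_eq]
  simp only [h2]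

end walk

/-! ### Existence by time change, and uniqueness. -/

lemma exists_massL : ∃ ℓ : L1 →L[ℝ] ℝ, ∀ g : L1, ℓ g = ∫ x in Ici 0, g x := by
  obtain ⟨ℓ, h, -⟩ := exists_pairingL (φ := fun _ => 1) (C := 1) aestronglyMeasurable_const (by simp)
  exact ⟨ℓ, fun g => by simpa using h g⟩

lemma setIntegral_mul_indicator_Ici {ε : ℝ} (hε : 0 ≤ ε) (g : ℝ → ℝ) :
    ∫ x in Ici 0, g x * (Ici ε).indicator (fun _ => (1 : ℝ)) x = ∫ x in Ici ε, g x := by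
  rw [← setIntegral_halfLine_indicator hε]
  congr 1; ext x
  simp only [indicator]; split_ifs <;> simp

lemma abs_indicator_one_le (s : Set ℝ) (x : ℝ) : |s.indicator (fun _ => (1 : ℝ)) x| ≤ 1 := by
  simp only [indicator]; split_ifs <;> simp

lemma exists_tailL {ε : ℝ} (hε : 0 < ε) :
    ∃ ℓ : L1 →L[ℝ] ℝ, (∀ g : L1, ℓ g = tailMass ε g) ∧ ∀ g : L1, |ℓ g| ≤ ‖g‖ := by
  obtain ⟨ℓ, h, hb⟩ := exists_pairingL (φ := (Ici ε).indicator (fun _ => (1 : ℝ))) (C := 1)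
    (measurable_const.indicator measurableSet_Ici).aestronglyMeasurable
    (fun x _ => abs_indicator_one_le _ x)
  exact ⟨ℓ, fun g => (h g).trans (setIntegral_mul_indicator_Ici hε.le _),
    fun g => by simpa using hb g⟩

lemma tailMass_congr {ε : ℝ} (hε : 0 ≤ ε) {g h : ℝ → ℝ} (hgh : g =ᵐ[halfLine] h) :
    tailMass ε g = tailMass ε h :=
  integral_congr_ae (ae_mono (Measure.restrict_mono (Ici_subset_Ici.2 hε) le_rfl) hgh)

/-- A measurable, everywhere nonnegative and bounded integrable datum on the half-line. -/
structure IsDatum (M : ℝ) (h : ℝ → ℝ) : Prop where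
  measurable : Measurable h
  nonneg : ∀ x, 0 ≤ h x
  le : ∀ x, h x ≤ M
  integrable : Integrable h halfLine

section exist
variable {ε M : ℝ} {h : ℝ → ℝ} {J : L1 →L[ℝ] L1} {F : L1}

lemma integral_semigroup (hε : 0 < ε)
    (hJ : ∀ g : L1, (J g : ℝ → ℝ) =ᵐ[halfLine] jump ε g) (F : L1) (τ : ℝ) :
    ∫ x in Ici 0, semigroup J τ F x = ∫ x in Ici 0, F x := by
  obtain ⟨ℓ, hℓ⟩ := exists_massL
  have hd : ∀ s, HasDerivAt (fun s => ℓ (semigroup J s F)) 0 s := fun s => by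
    have := (ℓ.hasFDerivAt (x := semigroup J s F)).comp_hasDerivAt s (hasDerivAt_semigroup J F s)
    refine this.congr_deriv ?_
    rw [hℓ, integral_congr_ae (hJ _), integral_jump hε (L1.integrable_coeFn _)]
  have := is_const_of_deriv_eq_zero (fun s => (hd s).differentiableAt) (fun s => (hd s).deriv) τ 0
  rw [← hℓ, ← hℓ]
  simpa [semigroup_zero] using this

lemma semigroup_nonneg (hε : 0 < ε)
    (hJ : ∀ g : L1, (J g : ℝ → ℝ) =ᵐ[halfLine] jump ε g) (hh : IsDatum M h)
    (hF : (F : ℝ → ℝ) =ᵐ[halfLine] h) {τ : ℝ} (hτ : 0 ≤ τ) :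
    ∀ᵐ x ∂halfLine, 0 ≤ (semigroup J τ F : ℝ → ℝ) x := by
  filter_upwards [semigroup_ae_eq_walkSum hε hJ hF τ] with x hx
  rw [hx]; exact walkSum_nonneg hh.nonneg hτ x

lemma norm_semigroup (hε : 0 < ε)
    (hJ : ∀ g : L1, (J g : ℝ → ℝ) =ᵐ[halfLine] jump ε g) (hh : IsDatum M h)
    (hF : (F : ℝ → ℝ) =ᵐ[halfLine] h) {τ : ℝ} (hτ : 0 ≤ τ) :
    ‖semigroup J τ F‖ = ∫ x in Ici 0, F x := by
  rw [L1.norm_eq_integral_norm, ← integral_semigroup hε hJ F τ]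
  refine integral_congr_ae ?_
  filter_upwards [semigroup_nonneg hε hJ hh hF hτ] with x hx
  rw [Real.norm_eq_abs, abs_of_nonneg hx]

lemma tailMass_nonneg {ε : ℝ} (hε : 0 ≤ ε) {g : ℝ → ℝ} (hg : ∀ᵐ x ∂halfLine, 0 ≤ g x) :
    0 ≤ tailMass ε g :=
  integral_nonneg_of_ae (ae_mono (Measure.restrict_mono (Ici_subset_Ici.2 hε) le_rfl) hg)

/-- The time change turning the linear semigroup into a solution of the kinetic equation. -/
lemma exists_timeChange (hε : 0 < ε) {K T : ℝ} (hK : 0 ≤ K) (hT : 0 < T)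
    (hJ : ∀ g : L1, (J g : ℝ → ℝ) =ᵐ[halfLine] jump ε g) (hh : IsDatum M h)
    (hF : (F : ℝ → ℝ) =ᵐ[halfLine] h) :
    ∃ τ : ℝ → ℝ, Continuous τ ∧ τ 0 = 0 ∧ (∀ t, 0 ≤ τ t) ∧
      ∀ t ∈ Icc 0 T, HasDerivWithinAt τ (K * tailMass ε (semigroup J (τ t) F)) (Icc 0 T) t := by
  obtain ⟨ℓ, hℓ, hℓb⟩ := exists_tailL hε
  set ρ := ∫ x in Ici 0, F x with hρ
  have hnorm : ∀ {s}, 0 ≤ s → ‖semigroup J s F‖ = ρ := fun hs => norm_semigroup hε hJ hh hF hs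
  have hρ0 : 0 ≤ ρ := (hnorm le_rfl) ▸ norm_nonneg _
  -- Clamping at 0 makes the scalar field globally bounded and Lipschitz, since positivity and the
  -- norm identity are known only for $s\ge0$. The solution is nondecreasing from 0, so the clamp is
  -- never active.
  set m : ℝ → ℝ := fun s => K * ℓ (semigroup J (max s 0) F) with hm
  have hm0 : ∀ s, 0 ≤ m s := fun s => mul_nonneg hK (by
    rw [hℓ]; exact tailMass_nonneg hε.le (semigroup_nonneg hε hJ hh hF (le_max_right s 0)))
  have hmb : ∀ s, ‖m s‖ ≤ K * ρ := fun s => by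
    rw [hm, norm_mul, Real.norm_of_nonneg hK, ← hnorm (le_max_right s 0)]
    gcongr
    exact hℓb _
  have hSL : ∀ s ∈ Ici (0 : ℝ), ∀ r ∈ Ici (0 : ℝ),
      ‖semigroup J r F - semigroup J s F‖ ≤ (‖J‖ * ρ) * ‖r - s‖ := fun s hs r hr =>
    Convex.norm_image_sub_le_of_norm_hasDerivWithin_le
      (fun x _ => (hasDerivAt_semigroup J F x).hasDerivWithinAt)
      (fun x hx => (J.le_opNorm _).trans (by rw [hnorm hx])) (convex_Ici 0) hs hr
  have hmL : LipschitzWith (K * (‖J‖ * ρ)).toNNReal m := by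
    refine LipschitzWith.of_dist_le_mul fun s r => ?_
    rw [Real.coe_toNNReal _ (by positivity), Real.dist_eq, Real.dist_eq, hm]
    simp only
    rw [← mul_sub, ← map_sub, abs_mul, abs_of_nonneg hK, mul_assoc]
    gcongr
    refine (hℓb _).trans ((hSL _ (le_max_right r 0) _ (le_max_right s 0)).trans ?_)
    gcongr
    exact abs_max_sub_max_le_abs s r 0
  -- A field bounded by $K\rho$ moves the solution by at most $K\rho T$, so with this radius one
  -- application covers all of $[0,T]$.
  have hpl : IsPicardLindelof (fun _ s => m s) (tmin := 0) (tmax := T) ⟨0, le_rfl, hT.le⟩ (0 : ℝ)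
      ((K * ρ).toNNReal * T.toNNReal) 0 (K * ρ).toNNReal (K * (‖J‖ * ρ)).toNNReal :=
    { lipschitzOnWith := fun _ _ => hmL.lipschitzOnWith
      continuousOn := fun _ _ => continuousOn_const
      norm_le := fun _ _ s _ => by
        rw [Real.coe_toNNReal _ (by positivity)]; exact hmb s
      mul_max_le := by
        simp only [NNReal.coe_mul, NNReal.coe_zero, sub_zero, sub_self, max_eq_left hT.le,
          Real.coe_toNNReal _ hT.le]
        exact le_rfl }
  obtain ⟨α, hα0, hα⟩ := hpl.exists_eq_forall_mem_Icc_hasDerivWithinAt₀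
  have hαc : ContinuousOn α (Icc 0 T) := fun t ht => (hα t ht).continuousWithinAt
  have hαm : MonotoneOn α (Icc 0 T) := by
    refine monotoneOn_of_hasDerivWithinAt_nonneg (convex_Icc 0 T) hαc
      (fun x hx => ((hα x (interior_subset hx)).mono interior_subset)) (fun x _ => hm0 _)
  have hα0' : α 0 = 0 := hα0
  have h0T : (0 : ℝ) ∈ Icc 0 T := ⟨le_rfl, hT.le⟩
  -- The constant extension gives continuity and nonnegativity on all of $\mathbb R$, later needed
  -- for joint measurability and for bounds at every $t$.
  refine ⟨IccExtend hT.le ((Icc 0 T).domRestrict α), hαc.domRestrict.Icc_extend', ?_, ?_, ?_⟩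
  · rw [IccExtend_of_mem hT.le _ h0T]; exact hα0
  · intro t
    have hp := (projIcc 0 T hT.le t).2
    have := hαm h0T hp hp.1
    rw [hα0'] at this
    exact this
  · intro t ht
    have e : ∀ s ∈ Icc 0 T, IccExtend hT.le ((Icc 0 T).domRestrict α) s = α s := fun s hs =>
      IccExtend_of_mem hT.le _ hs
    have hpos : 0 ≤ α t := by
      have := hαm h0T ht ht.1
      rwa [hα0'] at this
    rw [e t ht, ← hℓ]
    have : HasDerivWithinAt (IccExtend hT.le ((Icc 0 T).domRestrict α)) (m (α t)) (Icc 0 T) t :=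
      (hα t ht).congr e (e t ht)
    simpa only [hm, max_eq_left hpos] using this

lemma collision_ae_eq (hJ : ∀ g : L1, (J g : ℝ → ℝ) =ᵐ[halfLine] jump ε g) (η : ℝ) (g : L1) :
    (((η / (3 * ε ^ 2) * tailMass ε g) • J g : L1) : ℝ → ℝ) =ᵐ[halfLine] collision η ε g := by
  filter_upwards [Lp.coeFn_smul (η / (3 * ε ^ 2) * tailMass ε g) (J g), hJ g] with x h1 h2
  rw [h1, Pi.smul_apply, h2, smul_eq_mul, collision]

lemma isKineticSolution_timeChange {η T : ℝ} {fin : ℝ → ℝ} {τ : ℝ → ℝ}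
    (hJ : ∀ g : L1, (J g : ℝ → ℝ) =ᵐ[halfLine] jump ε g)
    (hF : (F : ℝ → ℝ) =ᵐ[halfLine] fin) (hτ0 : τ 0 = 0)
    (hτ : ∀ t ∈ Icc 0 T, HasDerivWithinAt τ
      (η / (3 * ε ^ 2) * tailMass ε (semigroup J (τ t) F)) (Icc 0 T) t) :
    IsKineticSolution η T ε fin (fun t => semigroup J (τ t) F) := by
  have hd : ∀ t ∈ Icc 0 T, HasDerivWithinAt (fun t => semigroup J (τ t) F)
      ((η / (3 * ε ^ 2) * tailMass ε (semigroup J (τ t) F)) • J (semigroup J (τ t) F))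
      (Icc 0 T) t := fun t ht => (hasDerivAt_semigroup J F (τ t)).scomp_hasDerivWithinAt t (hτ t ht)
  refine ⟨fun t ht => (hd t ht).continuousWithinAt, ?_, fun t ht => ⟨_, collision_ae_eq hJ η _, hd t ht⟩⟩
  simpa [hτ0, semigroup_zero] using hF

lemma IsKineticSolution.hasDerivWithinAt {η T : ℝ} {fin : ℝ → ℝ} {u : ℝ → L1}
    (hJ : ∀ g : L1, (J g : ℝ → ℝ) =ᵐ[halfLine] jump ε g) (hu : IsKineticSolution η T ε fin u)
    {t : ℝ} (ht : t ∈ Icc 0 T) :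
    HasDerivWithinAt u ((η / (3 * ε ^ 2) * tailMass ε (u t)) • J (u t)) (Icc 0 T) t := by
  obtain ⟨v, hv, hd⟩ := hu.equation t ht
  convert hd using 1
  exact Lp.ext ((collision_ae_eq hJ η (u t)).trans hv.symm)

/-- The vector field is quadratic in $L^1$, hence Lipschitz on balls; both solutions are continuous
on a compact interval and stay in a common ball. -/
lemma IsKineticSolution.eqOn {η T : ℝ} {fin : ℝ → ℝ} {u v : ℝ → L1} (hε : 0 < ε)
    (hu : IsKineticSolution η T ε fin u) (hv : IsKineticSolution η T ε fin v) :
    EqOn v u (Icc 0 T) := by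
  obtain ⟨J, hJ⟩ := exists_jumpL hε
  obtain ⟨ℓ, hℓ, hℓb⟩ := exists_tailL hε
  set K := η / (3 * ε ^ 2) with hK
  obtain ⟨R₁, hR₁⟩ := isCompact_Icc.exists_bound_of_continuousOn hu.continuousOn
  obtain ⟨R₂, hR₂⟩ := isCompact_Icc.exists_bound_of_continuousOn hv.continuousOn
  set R := max (max R₁ R₂) 0 with hR
  have hR0 : 0 ≤ R := le_max_right _ _
  have hRu : ∀ t ∈ Icc 0 T, u t ∈ Metric.closedBall (0 : L1) R := fun t ht =>
    mem_closedBall_zero_iff.2 <| (hR₁ t ht).trans ((le_max_left _ _).trans (le_max_left _ _))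
  have hRv : ∀ t ∈ Icc 0 T, v t ∈ Metric.closedBall (0 : L1) R := fun t ht =>
    mem_closedBall_zero_iff.2 <| (hR₂ t ht).trans ((le_max_right _ _).trans (le_max_left _ _))
  have hLip : LipschitzOnWith (|K| * (2 * R * ‖J‖)).toNNReal (fun g : L1 => (K * ℓ g) • J g)
      (Metric.closedBall 0 R) := by
    refine LipschitzOnWith.of_dist_le_mul fun f hf g hg => ?_
    rw [mem_closedBall_zero_iff] at hf hg
    rw [Real.coe_toNNReal _ (by positivity), dist_eq_norm, dist_eq_norm]
    have e : (K * ℓ f) • J f - (K * ℓ g) • J g = K • (ℓ f • J (f - g) + ℓ (f - g) • J g) := by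
      rw [map_sub, map_sub]; module
    rw [e, norm_smul, Real.norm_eq_abs, mul_assoc]
    gcongr
    refine (norm_add_le _ _).trans ?_
    rw [norm_smul, norm_smul]
    have h1 : ‖ℓ f‖ * ‖J (f - g)‖ ≤ R * (‖J‖ * ‖f - g‖) := by
      gcongr
      · exact (hℓb f).trans hf
      · exact J.le_opNorm _
    have h2 : ‖ℓ (f - g)‖ * ‖J g‖ ≤ ‖f - g‖ * (‖J‖ * R) := by
      gcongr
      · exact hℓb _
      · exact (J.le_opNorm _).trans (by gcongr)
    calc _ ≤ R * (‖J‖ * ‖f - g‖) + ‖f - g‖ * (‖J‖ * R) := add_le_add h1 h2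
      _ = _ := by ring
  have hderiv : ∀ {w : ℝ → L1}, IsKineticSolution η T ε fin w → ∀ t ∈ Ico 0 T,
      HasDerivWithinAt w ((K * ℓ (w t)) • J (w t)) (Ici t) t := fun hw t ht => by
    have := hw.hasDerivWithinAt hJ (Ico_subset_Icc_self ht)
    rw [hℓ]
    refine (this.mono (Icc_subset_Icc_left ht.1)).mono_of_mem_nhdsWithin ?_
    exact Icc_mem_nhdsGE ht.2
  exact ODE_solution_unique_of_mem_Icc_right (v := fun _ g => (K * ℓ g) • J g)
    (s := fun _ => Metric.closedBall 0 R) (fun _ _ => hLip) hv.continuousOn (hderiv hv)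
    (fun t ht => hRv t (Ico_subset_Icc_self ht)) hu.continuousOn (hderiv hu)
    (fun t ht => hRu t (Ico_subset_Icc_self ht)) (Lp.ext (hv.initial.trans hu.initial.symm))

end exist

/-! ### Space-time measurability and differentiation of pairings. -/

/-- Lebesgue measure on the space-time strip `[0,T] × [0,∞)`. -/
noncomputable abbrev strip (T : ℝ) : Measure (ℝ × ℝ) := (volume.restrict (Icc 0 T)).prod halfLine

lemma volume_restrict_strip (T : ℝ) :
    (volume : Measure (ℝ × ℝ)).restrict (Icc 0 T ×ˢ Ici 0) = strip T := by
  rw [strip, halfLine, Measure.prod_restrict, Measure.volume_eq_prod]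

lemma ae_strip_mem (T : ℝ) : ∀ᵐ p ∂strip T, p.1 ∈ Icc 0 T ∧ 0 ≤ p.2 := by
  rw [← volume_restrict_strip]
  filter_upwards [ae_restrict_mem (measurableSet_Icc.prod measurableSet_Ici)] with p hp using hp

/-- Clamping both variables; a globally continuous function makes the shifted values in the second
difference measurable. -/
lemma exists_continuous_extension {T : ℝ} (hT : 0 ≤ T) {φ : ℝ → ℝ → ℝ}
    (hφ : ContinuousOn (Function.uncurry φ) (Icc 0 T ×ˢ Ici 0)) :
    ∃ ψ : ℝ → ℝ → ℝ, Continuous (Function.uncurry ψ) ∧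
      ∀ t ∈ Icc 0 T, ∀ x, 0 ≤ x → φ t x = ψ t x := by
  refine ⟨fun t x => φ (projIcc 0 T hT t) (max x 0), ?_, ?_⟩
  · refine hφ.comp_continuous (f := fun p : ℝ × ℝ => ((projIcc 0 T hT p.1 : ℝ), max p.2 0))
      ?_ fun p =>
        ⟨(projIcc 0 T hT p.1).2, mem_Ici.2 (le_max_right p.2 0)⟩
    exact ((continuous_subtype_val.comp continuous_projIcc).comp continuous_fst).prodMk
      (continuous_snd.max continuous_const)
  · intro t ht x hx
    simp only [projIcc_of_mem hT ht, max_eq_left hx]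

lemma aestronglyMeasurable_strip {T : ℝ} {φ : ℝ → ℝ → ℝ}
    (hφ : ContinuousOn (Function.uncurry φ) (Icc 0 T ×ˢ Ici 0)) :
    AEStronglyMeasurable (Function.uncurry φ) (strip T) := by
  rw [← volume_restrict_strip]
  exact hφ.aestronglyMeasurable (measurableSet_Icc.prod measurableSet_Ici)

lemma continuousOn_slice {T t : ℝ} (ht : t ∈ Icc 0 T) {φ : ℝ → ℝ → ℝ}
    (hφ : ContinuousOn (Function.uncurry φ) (Icc 0 T ×ˢ Ici 0)) : ContinuousOn (φ t) (Ici 0) :=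
  hφ.comp (f := fun x => (t, x)) (by fun_prop) fun _ hx => ⟨ht, hx⟩

lemma aestronglyMeasurable_slice {T t : ℝ} (ht : t ∈ Icc 0 T) {φ : ℝ → ℝ → ℝ}
    (hφ : ContinuousOn (Function.uncurry φ) (Icc 0 T ×ˢ Ici 0)) :
    AEStronglyMeasurable (φ t) halfLine :=
  (continuousOn_slice ht hφ).aestronglyMeasurable measurableSet_Ici

/-- The second difference of `φ t`, cut off to `x ≥ ε`. -/
noncomputable def secondDiff (ε : ℝ) (φ : ℝ → ℝ → ℝ) (t x : ℝ) : ℝ :=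
  (Ici ε).indicator (fun x => φ t (x + ε) + φ t (x - ε) - 2 * φ t x) x

lemma aestronglyMeasurable_secondDiff {T ε : ℝ} (hT : 0 ≤ T) (hε : 0 < ε) {φ : ℝ → ℝ → ℝ}
    (hφ : ContinuousOn (Function.uncurry φ) (Icc 0 T ×ˢ Ici 0)) :
    AEStronglyMeasurable (Function.uncurry (secondDiff ε φ)) (strip T) := by
  obtain ⟨ψ, hψ, he⟩ := exists_continuous_extension hT hφ
  refine AEStronglyMeasurable.congr (f := (Prod.snd ⁻¹' (Ici ε)).indicator
    (fun p : ℝ × ℝ => ψ p.1 (p.2 + ε) + ψ p.1 (p.2 - ε) - 2 * ψ p.1 p.2)) ?_ ?_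
  · refine (Measurable.indicator (Continuous.measurable ?_)
      (measurable_snd measurableSet_Ici)).aestronglyMeasurable
    have h1 : Continuous fun p : ℝ × ℝ => ψ p.1 (p.2 + ε) :=
      hψ.comp (by fun_prop : Continuous fun p : ℝ × ℝ => (p.1, p.2 + ε))
    have h2 : Continuous fun p : ℝ × ℝ => ψ p.1 (p.2 - ε) :=
      hψ.comp (by fun_prop : Continuous fun p : ℝ × ℝ => (p.1, p.2 - ε))
    exact (h1.add h2).sub (continuous_const.mul hψ)
  · filter_upwards [ae_strip_mem T] with p hp
    simp only [Function.uncurry, secondDiff, indicator, mem_preimage, mem_Ici]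
    split_ifs with hx
    · rw [he _ hp.1 _ hp.2, he _ hp.1 (p.2 + ε) (by linarith), he _ hp.1 (p.2 - ε) (by linarith)]
    · rfl

lemma integral_mul_secondDiff {ε : ℝ} (hε : 0 < ε) (g : ℝ → ℝ) (φ : ℝ → ℝ → ℝ) (t : ℝ) :
    ∫ x in Ici ε, g x * (φ t (x + ε) + φ t (x - ε) - 2 * φ t x)
      = ∫ x in Ici 0, g x * secondDiff ε φ t x := by
  rw [← setIntegral_halfLine_indicator hε.le]
  congr 1; ext x
  simp only [secondDiff, indicator]; split_ifs <;> simp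

section deriv

/-- A product rule in which $u$ is differentiable in norm while $\varphi$ is differentiable only
pointwise in $x$, with bounded derivative; dominated convergence replaces the missing uniformity. -/
lemma hasDerivWithinAt_pairing {T t : ℝ} (ht : t ∈ Icc 0 T) {u : ℝ → L1} {v : L1}
    (hu : HasDerivWithinAt u v (Icc 0 T) t) {φ φt φx φxx : ℝ → ℝ → ℝ}
    (hφ : IsTestFunction T φ φt φx φxx) :
    HasDerivWithinAt (fun s => ∫ x in Ici 0, u s x * φ s x)
      ((∫ x in Ici 0, v x * φ t x) + ∫ x in Ici 0, u t x * φt t x) (Icc 0 T) t := by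
  obtain ⟨C, hC⟩ := hφ.bounded φ (by simp)
  obtain ⟨C', hC'⟩ := hφ.bounded φt (by simp)
  have hm : ∀ s ∈ Icc 0 T, AEStronglyMeasurable (φ s) halfLine := fun s hs =>
    aestronglyMeasurable_slice hs (hφ.continuousOn φ (by simp))
  have hi : ∀ (g : L1), ∀ s ∈ Icc 0 T, Integrable (fun x => g x * φ s x) halfLine := fun g s hs =>
    (L1.integrable_coeFn g).mul_bdd (hm s hs) (c := C) (by
      filter_upwards [ae_restrict_mem measurableSet_Ici] with x hx using hC s hs x hx)
  have hdiff : ∀ s ∈ Icc 0 T, ∀ x ∈ Ici (0 : ℝ), |φ s x - φ t x| ≤ C' * |s - t| :=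
    fun s hs x hx => Convex.norm_image_sub_le_of_norm_hasDerivWithin_le
      (fun r hr => hφ.hasDeriv_t r hr x hx) (fun r hr => hC' r hr x hx) (convex_Icc 0 T) ht hs
  rw [hasDerivWithinAt_iff_tendsto_slope] at hu ⊢
  set l := 𝓝[Icc 0 T \ {t}] t with hl
  have hmem : ∀ᶠ s in l, s ∈ Icc 0 T \ {t} := self_mem_nhdsWithin
  have hle : l ≤ 𝓝[Icc 0 T] t := nhdsWithin_mono _ sdiff_subset
  -- The difference quotient of the product is split as
  -- $(\mathrm{slope}\,u-v)\varphi_s+v\varphi_s+u_t\,\mathrm{slope}\,\varphi$.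
  have h1 : Tendsto (fun s => ∫ x in Ici 0, (slope u t s - v : L1) x * φ s x) l (𝓝 0) := by
    have : Tendsto (fun s => C * ‖slope u t s - v‖) l (𝓝 0) := by
      have := (tendsto_iff_norm_sub_tendsto_zero.1 hu).const_mul C
      simpa using this
    refine squeeze_zero_norm' ?_ this
    filter_upwards [hmem] with s hs
    obtain ⟨ℓ, e, hb⟩ := exists_pairingL (hm s hs.1) (hC s hs.1)
    rw [← e]; exact hb _
  have h2 : Tendsto (fun s => ∫ x in Ici 0, v x * φ s x) l (𝓝 (∫ x in Ici 0, v x * φ t x)) := by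
    refine tendsto_integral_filter_of_dominated_convergence (fun x => C * ‖v x‖) ?_ ?_
      ((L1.integrable_coeFn v).norm.const_mul C) ?_
    · filter_upwards [hmem] with s hs using (hi v s hs.1).aestronglyMeasurable
    · filter_upwards [hmem] with s hs
      filter_upwards [ae_restrict_mem measurableSet_Ici] with x hx
      rw [norm_mul, mul_comm]
      exact mul_le_mul_of_nonneg_right (hC s hs.1 x hx) (norm_nonneg _)
    · filter_upwards [ae_restrict_mem measurableSet_Ici] with x hx
      exact ((hφ.hasDeriv_t t ht x hx).continuousWithinAt.tendsto.mono_left hle).const_mul _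
  have h3 : Tendsto (fun s => ∫ x in Ici 0, u t x * slope (fun r => φ r x) t s) l
      (𝓝 (∫ x in Ici 0, u t x * φt t x)) := by
    refine tendsto_integral_filter_of_dominated_convergence (fun x => C' * ‖u t x‖) ?_ ?_
      ((L1.integrable_coeFn (u t)).norm.const_mul C') ?_
    · filter_upwards [hmem] with s hs
      refine (L1.integrable_coeFn (u t)).aestronglyMeasurable.mul ?_
      simp only [slope_def_field, div_eq_mul_inv]
      exact ((hm s hs.1).sub (hm t ht)).mul_const _
    · filter_upwards [hmem] with s hs
      filter_upwards [ae_restrict_mem measurableSet_Ici] with x hx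
      rw [norm_mul, mul_comm]
      refine mul_le_mul_of_nonneg_right ?_ (norm_nonneg _)
      rw [slope_def_field, norm_div, div_le_iff₀ (norm_pos_iff.2 (sub_ne_zero.2 hs.2))]
      exact hdiff s hs.1 x hx
    · filter_upwards [ae_restrict_mem measurableSet_Ici] with x hx
      exact (hasDerivWithinAt_iff_tendsto_slope.1 (hφ.hasDeriv_t t ht x hx)).const_mul _
  have h4 := (h1.add h2).add h3
  rw [zero_add] at h4
  refine h4.congr' ?_
  filter_upwards [hmem] with s hs
  have hst : s - t ≠ 0 := sub_ne_zero.2 hs.2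
  have hi3 : Integrable (fun x => u t x * slope (fun r => φ r x) t s) halfLine := by
    refine (((hi (u t) s hs.1).sub (hi (u t) t ht)).div_const (s - t)).congr (ae_of_all _ fun x => ?_)
    simp only [slope_def_field, Pi.sub_apply]; ring
  have hi12 : Integrable (fun x => (slope u t s - v : L1) x * φ s x + v x * φ s x) halfLine :=
    (hi _ s hs.1).add (hi _ s hs.1)
  rw [← integral_add (hi _ s hs.1) (hi _ s hs.1), ← integral_add hi12 hi3,
    slope_def_field, ← integral_sub (hi _ s hs.1) (hi _ t ht), ← integral_div]
  refine integral_congr_ae ?_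
  have es : slope u t s = (s - t)⁻¹ • (u s - u t) := by simp [slope]
  filter_upwards [Lp.coeFn_sub (slope u t s) v, Lp.coeFn_smul (s - t)⁻¹ (u s - u t),
    Lp.coeFn_sub (u s) (u t)] with x e1 e2 e3
  rw [e1, Pi.sub_apply, es, e2, Pi.smul_apply, e3, Pi.sub_apply, slope_def_field, smul_eq_mul]
  field_simp
  ring

end deriv

/-! ### A priori estimates uniform in the jump size. -/

/-- The properties of a solution of the kinetic equation, in a jointly measurable version, that
are used to pass to the limit. -/
structure IsProfile (η T ε M : ℝ) (h : ℝ → ℝ) (U : ℝ → ℝ → ℝ) : Prop where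
  measurable : Measurable (Function.uncurry U)
  nonneg : ∀ t x, 0 ≤ U t x
  le : ∀ t x, ε ≤ x → U t x ≤ M
  integrable : ∀ t ∈ Icc 0 T, Integrable (U t) halfLine
  mass_eq : ∀ t ∈ Icc 0 T, ∫ x in Ici 0, U t x = ∫ x in Ici 0, h x
  antitone : AntitoneOn (fun t => tailMass ε (U t)) (Icc 0 T)
  barrier : ∀ t ∈ Icc 0 T, ∀ L, 0 < L → ε ≤ L / 2 → ∀ x, ε ≤ x → x ≤ L →
    U t x ≤ M * (x / L + Real.exp (-(2 * (η / (3 * ε ^ 2) * t * tailMass ε (U t)) *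
      (1 - Real.cos (ε / L)))))
  tight : ∀ t ∈ Icc 0 T, ∀ R, 0 < R → ∫ x in Ici R, U t x ≤
    (∫ x in Ici 0, h x * min (x ^ 2 / R ^ 2) 1)
      + 2 * η * (∫ x in Ici 0, h x) ^ 2 * T / (3 * R ^ 2)
  weak : ∀ φ φt φx φxx, IsTestFunction T φ φt φx φxx →
    (∫ t in Icc 0 T, ∫ x in Ici 0, U t x * φt t x)
      + η / (3 * ε ^ 2) * (∫ t in Icc 0 T, tailMass ε (U t) *
          ∫ x in Ici 0, U t x * secondDiff ε φ t x)
      + (∫ x in Ici 0, h x * φ 0 x) = 0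

section
variable {η T ε M : ℝ} {h fin : ℝ → ℝ} {u : ℝ → L1} {J : L1 →L[ℝ] L1} {F : L1}

/-- Time derivative of the pairing of a solution with a bounded function of `x`. -/
lemma IsKineticSolution.hasDerivWithinAt_pairing (hε : 0 < ε)
    (hu : IsKineticSolution η T ε fin u) {t : ℝ} (ht : t ∈ Icc 0 T) {φ : ℝ → ℝ} {C : ℝ}
    (hφ : AEStronglyMeasurable φ halfLine) (hC : ∀ x ∈ Ici (0 : ℝ), |φ x| ≤ C) :
    HasDerivWithinAt (fun s => ∫ x in Ici 0, u s x * φ x)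
      (η / (3 * ε ^ 2) * tailMass ε (u t) *
        ∫ x in Ici ε, u t x * (φ (x + ε) + φ (x - ε) - 2 * φ x)) (Icc 0 T) t := by
  obtain ⟨J, hJ⟩ := exists_jumpL hε
  obtain ⟨ℓ, hℓ, -⟩ := exists_pairingL hφ hC
  have h1 := (ℓ.hasFDerivAt (x := u t)).comp_hasDerivWithinAt t (hu.hasDerivWithinAt hJ ht)
  have h2 : ℓ (J (u t)) = ∫ x in Ici ε, u t x * (φ (x + ε) + φ (x - ε) - 2 * φ x) := by
    rw [hℓ, ← integral_jump_mul hε (L1.integrable_coeFn (u t)) hφ hC]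
    refine integral_congr_ae ?_
    filter_upwards [hJ (u t)] with x hx
    rw [hx]
  rw [map_smul, h2, smul_eq_mul] at h1
  exact h1.congr_of_mem (fun s _ => (hℓ (u s)).symm) ht

lemma antitoneOn_of_hasDerivWithinAt_Icc {f f' : ℝ → ℝ} {a b : ℝ}
    (hf : ∀ t ∈ Icc a b, HasDerivWithinAt f (f' t) (Icc a b) t)
    (hf' : ∀ t ∈ Icc a b, f' t ≤ 0) : AntitoneOn f (Icc a b) :=
  antitoneOn_of_hasDerivWithinAt_nonpos (convex_Icc a b)
    (fun t ht => (hf t ht).continuousWithinAt)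
    (fun x hx => ((hf x (interior_subset hx)).mono interior_subset))
    (fun x hx => hf' x (interior_subset hx))

/-- Mass enters $[0,\varepsilon)$ and never leaves: at $x\ge\varepsilon$ the second difference of
the indicator of $[\varepsilon,\infty)$ is $-1$ or $0$. -/
lemma IsKineticSolution.antitoneOn_tailMass (hη : 0 ≤ η) (hε : 0 < ε)
    (hu : IsKineticSolution η T ε fin u) (hu0 : ∀ t ∈ Icc 0 T, ∀ᵐ x ∂halfLine, 0 ≤ u t x) :
    AntitoneOn (fun t => tailMass ε (u t)) (Icc 0 T) := by
  have hd := fun t ht => hu.hasDerivWithinAt_pairing hε (t := t) ht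
    (φ := (Ici ε).indicator (fun _ => (1 : ℝ))) (C := 1)
    (measurable_const.indicator measurableSet_Ici).aestronglyMeasurable
    (fun x _ => abs_indicator_one_le _ x)
  simp only [setIntegral_mul_indicator_Ici hε.le] at hd
  refine antitoneOn_of_hasDerivWithinAt_Icc hd fun t ht => ?_
  refine mul_nonpos_of_nonneg_of_nonpos
    (mul_nonneg (by positivity) (tailMass_nonneg hε.le (hu0 t ht))) ?_
  refine integral_nonpos_of_ae ?_
  filter_upwards [ae_restrict_mem measurableSet_Ici,
    ae_mono (Measure.restrict_mono (Ici_subset_Ici.2 hε.le) le_rfl) (hu0 t ht)] with x hx h0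
  have hx' : ε ≤ x := hx
  refine mul_nonpos_of_nonneg_of_nonpos h0 ?_
  simp only [indicator, mem_Ici, hx', if_true]
  split_ifs <;> norm_num

/-- The solution is tested with $w=\min(x^2/R^2,1)$, which dominates the indicator of $[R,\infty)$.
Its second difference is at most $2\varepsilon^2/R^2$, as a minimum of a parabola and a constant, so
the factor $\varepsilon^{-2}$ cancels and the growth rate is independent of $\varepsilon$. -/
lemma IsKineticSolution.setIntegral_Ici_le (hη : 0 ≤ η) (hε : 0 < ε) (hT : 0 ≤ T)
    (hu : IsKineticSolution η T ε fin u) (hu0 : ∀ t ∈ Icc 0 T, ∀ᵐ x ∂halfLine, 0 ≤ u t x)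
    {ρ : ℝ} (hρ : ∀ t ∈ Icc 0 T, ∫ x in Ici 0, u t x = ρ) {t R : ℝ} (ht : t ∈ Icc 0 T)
    (hR : 0 < R) : ∫ x in Ici R, u t x ≤
      (∫ x in Ici 0, fin x * min (x ^ 2 / R ^ 2) 1) + 2 * η * ρ ^ 2 * T / (3 * R ^ 2) := by
  set w : ℝ → ℝ := fun x => min (x ^ 2 / R ^ 2) 1 with hw
  have hw0 : ∀ x, 0 ≤ w x := fun x => le_min (by positivity) zero_le_one
  have hwm : AEStronglyMeasurable w halfLine := by
    have : Continuous w := by fun_prop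
    exact this.aestronglyMeasurable
  have hwb : ∀ x ∈ Ici (0 : ℝ), |w x| ≤ 1 := fun x _ => by
    rw [abs_of_nonneg (hw0 x)]; exact min_le_right _ _
  have htail : ∀ s ∈ Icc 0 T, tailMass ε (u s) ≤ ρ := fun s hs => by
    rw [← hρ s hs]
    exact setIntegral_mono_set (L1.integrable_coeFn (u s)) (hu0 s hs)
      (Ici_subset_Ici.2 hε.le).eventuallyLE
  have hρ0 : 0 ≤ ρ := by
    rw [← hρ t ht]; exact integral_nonneg_of_ae (hu0 t ht)
  have hd := fun s hs => hu.hasDerivWithinAt_pairing hε (t := s) hs hwm hwb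
  set D : ℝ := 2 * η * ρ ^ 2 / (3 * R ^ 2) with hD
  have hD0 : 0 ≤ D := by positivity
  have hle : ∀ s ∈ Icc 0 T, η / (3 * ε ^ 2) * tailMass ε (u s) *
        (∫ x in Ici ε, u s x * (w (x + ε) + w (x - ε) - 2 * w x)) - D ≤ 0 := fun s hs => by
    have hsec : ∀ x, w (x + ε) + w (x - ε) - 2 * w x ≤ 2 * ε ^ 2 / R ^ 2 := fun x => by
      have h1 : w (x + ε) ≤ (x + ε) ^ 2 / R ^ 2 := min_le_left _ _
      have h2 : w (x - ε) ≤ (x - ε) ^ 2 / R ^ 2 := min_le_left _ _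
      have h3 : w (x + ε) ≤ 1 := min_le_right _ _
      have h4 : w (x - ε) ≤ 1 := min_le_right _ _
      have h6 : 0 ≤ 2 * ε ^ 2 / R ^ 2 := by positivity
      rcases min_choice (x ^ 2 / R ^ 2) 1 with h5 | h5
      · have : w x = x ^ 2 / R ^ 2 := h5
        rw [this]
        have : (x + ε) ^ 2 / R ^ 2 + (x - ε) ^ 2 / R ^ 2 - 2 * (x ^ 2 / R ^ 2)
          = 2 * ε ^ 2 / R ^ 2 := by ring
        linarith
      · have : w x = 1 := h5
        rw [this]; linarith
    have hI : ∫ x in Ici ε, u s x * (w (x + ε) + w (x - ε) - 2 * w x)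
        ≤ ∫ x in Ici ε, u s x * (2 * ε ^ 2 / R ^ 2) := by
      have hiu := L1.integrable_coeFn (u s)
      refine integral_mono_ae ?_ ?_ ?_
      · have a1 := integrableOn_mul_shift (b := ε) hε.le (by linarith) hiu hwm hwb
        have a2 := integrableOn_mul_shift (b := -ε) hε.le (by linarith) hiu hwm hwb
        have a3 := integrableOn_mul_shift (b := 0) hε.le (by linarith) hiu hwm hwb
        refine ((a1.add a2).sub (a3.const_mul 2)).congr (ae_of_all _ fun x => ?_)
        simp only [Pi.add_apply, Pi.sub_apply, add_zero, sub_eq_add_neg]; ring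
      · exact (hiu.mono_measure (Measure.restrict_mono (Ici_subset_Ici.2 hε.le) le_rfl)).mul_const _
      · filter_upwards [ae_mono (Measure.restrict_mono (Ici_subset_Ici.2 hε.le) le_rfl) (hu0 s hs)]
          with x h0
        exact mul_le_mul_of_nonneg_left (hsec x) h0
    rw [integral_mul_const] at hI
    have ht0 := tailMass_nonneg hε.le (hu0 s hs)
    have ht1 := htail s hs
    change _ ≤ tailMass ε (u s) * _ at hI
    have : η / (3 * ε ^ 2) * tailMass ε (u s) *
        (∫ x in Ici ε, u s x * (w (x + ε) + w (x - ε) - 2 * w x))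
        ≤ η / (3 * ε ^ 2) * ρ * (ρ * (2 * ε ^ 2 / R ^ 2)) := by
      refine (mul_le_mul_of_nonneg_left hI (mul_nonneg (by positivity) ht0)).trans ?_
      gcongr
    have e : η / (3 * ε ^ 2) * ρ * (ρ * (2 * ε ^ 2 / R ^ 2)) = D := by
      rw [hD]; field_simp
    linarith
  have hanti := antitoneOn_of_hasDerivWithinAt_Icc
    (fun s hs => (hd s hs).sub ((hasDerivWithinAt_id s (Icc 0 T)).const_mul D))
    (fun s hs => by simpa using hle s hs)
  have h0 : (0 : ℝ) ∈ Icc 0 T := ⟨le_rfl, hT⟩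
  have hfin := hanti h0 ht ht.1
  simp only [Pi.sub_apply, id, mul_zero, sub_zero] at hfin
  have hinit : ∫ x in Ici 0, u 0 x * w x = ∫ x in Ici 0, fin x * w x := by
    refine integral_congr_ae ?_
    filter_upwards [hu.initial] with x hx
    rw [hx]
  rw [hinit] at hfin
  have hlow : ∫ x in Ici R, u t x ≤ ∫ x in Ici 0, u t x * w x := by
    rw [← setIntegral_mul_indicator_Ici hR.le]
    have hiu := L1.integrable_coeFn (u t)
    refine integral_mono_ae
      (hiu.mul_bdd (measurable_const.indicator measurableSet_Ici).aestronglyMeasurable (c := 1)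
        (ae_of_all _ fun x => abs_indicator_one_le _ x))
      (hiu.mul_bdd hwm (c := 1) ?_) ?_
    · filter_upwards [ae_restrict_mem measurableSet_Ici] with x hx using hwb x hx
    · filter_upwards [hu0 t ht] with x h0
      refine mul_le_mul_of_nonneg_left ?_ h0
      simp only [indicator]
      split_ifs with hx
      · refine le_min ?_ le_rfl
        rw [one_le_div (by positivity)]
        exact pow_le_pow_left₀ hR.le hx 2
      · exact hw0 x
  have : D * t ≤ 2 * η * ρ ^ 2 * T / (3 * R ^ 2) := by
    calc D * t ≤ D * T := by gcongr; exact ht.2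
      _ = _ := by rw [hD]; ring
  linarith

end

section
variable {η T ε M : ℝ} {h fin : ℝ → ℝ}

lemma integrable_strip {ρ : ℝ} {U : ℝ → ℝ → ℝ}
    (hUm : Measurable (Function.uncurry U)) (hU0 : ∀ t x, 0 ≤ U t x)
    (hUi : ∀ t ∈ Icc 0 T, Integrable (U t) halfLine)
    (hρ : ∀ t ∈ Icc 0 T, ∫ x in Ici 0, U t x ≤ ρ) :
    Integrable (Function.uncurry U) (strip T) := by
  rw [strip, integrable_prod_iff hUm.aestronglyMeasurable]
  refine ⟨?_, ?_⟩
  · filter_upwards [ae_restrict_mem measurableSet_Icc] with t ht using hUi t ht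
  · refine Integrable.mono' (g := fun _ => ρ) (integrable_const _)
      (hUm.aestronglyMeasurable.norm.integral_prod_right' (μ := volume.restrict (Icc 0 T))
        (ν := halfLine)) ?_
    filter_upwards [ae_restrict_mem measurableSet_Icc] with t ht
    rw [Real.norm_of_nonneg (integral_nonneg fun _ => norm_nonneg _)]
    refine le_trans (le_of_eq ?_) (hρ t ht)
    exact integral_congr_ae (ae_of_all _ fun x => Real.norm_of_nonneg (hU0 t x))

lemma abs_secondDiff_le {φ : ℝ → ℝ → ℝ} {C t x : ℝ} (hε : 0 < ε)
    (hC : ∀ x ∈ Ici (0 : ℝ), |φ t x| ≤ C) : |secondDiff ε φ t x| ≤ 4 * C := by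
  have hC0 : 0 ≤ C := (abs_nonneg _).trans (hC 0 (mem_Ici.2 le_rfl))
  simp only [secondDiff, indicator, mem_Ici]
  split_ifs with hx
  · have h1 := abs_le.1 (hC (x + ε) (mem_Ici.2 (by linarith)))
    have h2 := abs_le.1 (hC (x - ε) (mem_Ici.2 (by linarith)))
    have h3 := abs_le.1 (hC x (mem_Ici.2 (by linarith)))
    rw [abs_le]; constructor <;> linarith [h1.1, h1.2, h2.1, h2.2, h3.1, h3.2]
  · simpa using hC0

/-- The time derivative of $\int u\varphi$ is integrated over $[0,T]$; only the initial boundary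
term survives because $\varphi(T,\cdot)=0$. -/
lemma IsKineticSolution.weak {ρ : ℝ} (hε : 0 < ε) (hT : 0 < T) {u : ℝ → L1}
    (hu : IsKineticSolution η T ε fin u) {U : ℝ → ℝ → ℝ}
    (hUm : Measurable (Function.uncurry U)) (hU0 : ∀ t x, 0 ≤ U t x)
    (hUu : ∀ t ∈ Icc 0 T, (u t : ℝ → ℝ) =ᵐ[halfLine] U t)
    (hρ : ∀ t ∈ Icc 0 T, ∫ x in Ici 0, U t x ≤ ρ) {φ φt φx φxx : ℝ → ℝ → ℝ}
    (hφ : IsTestFunction T φ φt φx φxx) :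
    (∫ t in Icc 0 T, ∫ x in Ici 0, U t x * φt t x)
      + η / (3 * ε ^ 2) * (∫ t in Icc 0 T, tailMass ε (U t) *
          ∫ x in Ici 0, U t x * secondDiff ε φ t x)
      + (∫ x in Ici 0, fin x * φ 0 x) = 0 := by
  obtain ⟨J, hJ⟩ := exists_jumpL hε
  obtain ⟨C, hC⟩ := hφ.bounded φ (by simp)
  obtain ⟨C', hC'⟩ := hφ.bounded φt (by simp)
  have hUi : ∀ t ∈ Icc 0 T, Integrable (U t) halfLine := fun t ht =>
    (L1.integrable_coeFn (u t)).congr (hUu t ht)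
  have hUstrip := integrable_strip hUm hU0 hUi hρ
  have hi1 : Integrable (fun t => ∫ x in Ici 0, U t x * φt t x) (volume.restrict (Icc 0 T)) := by
    refine Integrable.integral_prod_left (f := fun p : ℝ × ℝ => U p.1 p.2 * φt p.1 p.2)
      (ν := halfLine) ?_
    refine hUstrip.mul_bdd (c := C') (aestronglyMeasurable_strip (hφ.continuousOn φt (by simp))) ?_
    filter_upwards [ae_strip_mem T] with p hp using hC' _ hp.1 _ hp.2
  have hi2 : Integrable (fun t => ∫ x in Ici 0, U t x * secondDiff ε φ t x)
      (volume.restrict (Icc 0 T)) := by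
    refine Integrable.integral_prod_left (f := fun p : ℝ × ℝ => U p.1 p.2 * secondDiff ε φ p.1 p.2)
      (ν := halfLine) ?_
    refine hUstrip.mul_bdd (c := 4 * C)
      (aestronglyMeasurable_secondDiff hT.le hε (hφ.continuousOn φ (by simp))) ?_
    filter_upwards [ae_strip_mem T] with p hp using abs_secondDiff_le hε (hC _ hp.1)
  have htailm : AEStronglyMeasurable (fun t => tailMass ε (U t)) (volume.restrict (Icc 0 T)) :=
    hUm.stronglyMeasurable.integral_prod_right.aestronglyMeasurable
  have hi3 : Integrable (fun t => tailMass ε (U t) * ∫ x in Ici 0, U t x * secondDiff ε φ t x)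
      (volume.restrict (Icc 0 T)) := by
    refine hi2.bdd_mul (c := ρ) htailm ?_
    filter_upwards [ae_restrict_mem measurableSet_Icc] with t ht
    rw [Real.norm_of_nonneg (tailMass_nonneg hε.le (ae_of_all _ (hU0 t)))]
    exact (setIntegral_mono_set (hUi t ht) (ae_of_all _ (hU0 t))
      (Ici_subset_Ici.2 hε.le).eventuallyLE).trans (hρ t ht)
  set F : ℝ → ℝ := fun s => ∫ x in Ici 0, u s x * φ s x with hF
  set F' : ℝ → ℝ := fun t => (∫ x in Ici 0, U t x * φt t x) + η / (3 * ε ^ 2) *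
    (tailMass ε (U t) * ∫ x in Ici 0, U t x * secondDiff ε φ t x) with hF'
  have hd : ∀ t ∈ Icc 0 T, HasDerivWithinAt F (F' t) (Icc 0 T) t := fun t ht => by
    have h1 := ConstrainedKinetic.hasDerivWithinAt_pairing ht (hu.hasDerivWithinAt hJ ht) hφ
    refine h1.congr_deriv ?_
    have hm := aestronglyMeasurable_slice ht (hφ.continuousOn φ (by simp))
    have e1 : ∫ x in Ici 0, ((η / (3 * ε ^ 2) * tailMass ε (u t)) • J (u t) : L1) x * φ t x
        = η / (3 * ε ^ 2) * (tailMass ε (U t) * ∫ x in Ici 0, U t x * secondDiff ε φ t x) := by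
      rw [← integral_mul_secondDiff hε, ← integral_jump_mul hε (hUi t ht) hm (hC t ht),
        ← tailMass_congr hε.le (hUu t ht), ← mul_assoc, ← integral_const_mul]
      refine integral_congr_ae ?_
      filter_upwards [Lp.coeFn_smul (η / (3 * ε ^ 2) * tailMass ε (u t)) (J (u t)), hJ (u t),
        jump_congr_ae hε (hUu t ht)] with x h1 h2 h3
      rw [h1, Pi.smul_apply, h2, h3, smul_eq_mul, mul_assoc]
    have e2 : ∫ x in Ici 0, u t x * φt t x = ∫ x in Ici 0, U t x * φt t x := by
      refine integral_congr_ae ?_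
      filter_upwards [hUu t ht] with x hx
      rw [hx]
    rw [e1, e2, add_comm]
  have hF'i : Integrable F' (volume.restrict (Icc 0 T)) := hi1.add (hi3.const_mul _)
  have hftc := intervalIntegral.integral_eq_sub_of_hasDerivAt_of_le hT.le
    (fun t ht => (hd t ht).continuousWithinAt)
    (fun t ht => (hd t (Ioo_subset_Icc_self ht)).hasDerivAt (Icc_mem_nhds ht.1 ht.2))
    ((intervalIntegrable_iff_integrableOn_Icc_of_le hT.le).2 hF'i)
  rw [intervalIntegral.integral_of_le hT.le, ← integral_Icc_eq_integral_Ioc, hF',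
    integral_add hi1 (hi3.const_mul _), integral_const_mul] at hftc
  have hFT : F T = 0 := by
    refine (integral_congr_ae ?_).trans (integral_zero _ _)
    filter_upwards [ae_restrict_mem measurableSet_Ici] with x hx
    rw [hφ.final x hx, mul_zero]
  have hF0 : F 0 = ∫ x in Ici 0, fin x * φ 0 x := by
    refine integral_congr_ae ?_
    filter_upwards [hu.initial] with x hx
    rw [hx]
  rw [hftc, hFT, hF0]; ring

/-- Any solution of the kinetic equation is represented by a profile. -/
lemma IsKineticSolution.exists_profile (hη : 0 < η) (hT : 0 < T) (hε : 0 < ε) (hh : IsDatum M h)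
    {u : ℝ → L1} (hu : IsKineticSolution η T ε h u) :
    ∃ U, IsProfile η T ε M h U ∧ ∀ t ∈ Icc 0 T, (u t : ℝ → ℝ) =ᵐ[halfLine] U t := by
  obtain ⟨J, hJ⟩ := exists_jumpL hε
  set F : L1 := hh.integrable.toL1 with hFdef
  have hF : (F : ℝ → ℝ) =ᵐ[halfLine] h := hh.integrable.coeFn_toL1
  obtain ⟨τ, hτc, hτ0, hτn, hτ⟩ := exists_timeChange hε (K := η / (3 * ε ^ 2)) (by positivity)
    hT hJ hh hF
  -- Uniqueness identifies the given solution with the time-changed semigroup, so it inherits the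
  -- explicit bounds.
  have hEq : ∀ {t}, t ∈ Icc 0 T → semigroup J (τ t) F = u t := fun ht =>
    ((isKineticSolution_timeChange hJ hF hτ0 hτ).eqOn hε hu ht).symm
  set U : ℝ → ℝ → ℝ := fun t x => walkSum ε h (τ t) x with hU
  have hUu : ∀ t ∈ Icc 0 T, (u t : ℝ → ℝ) =ᵐ[halfLine] U t := fun t ht => by
    rw [← hEq ht]; exact semigroup_ae_eq_walkSum hε hJ hF (τ t)
  have hUm : Measurable (Function.uncurry U) :=
    (measurable_walkSum hh.measurable).comp
      ((hτc.measurable.comp measurable_fst).prodMk measurable_snd)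
  have hU0 : ∀ t x, 0 ≤ U t x := fun t x => walkSum_nonneg hh.nonneg (hτn t) x
  have hu0 : ∀ t ∈ Icc 0 T, ∀ᵐ x ∂halfLine, 0 ≤ u t x := fun t ht => by
    filter_upwards [hUu t ht] with x hx
    rw [hx]; exact hU0 t x
  have humass : ∀ t ∈ Icc 0 T, ∫ x in Ici 0, u t x = ∫ x in Ici 0, h x := fun t ht => by
    rw [← hEq ht, integral_semigroup hε hJ F, integral_congr_ae hF]
  have hmass : ∀ t ∈ Icc 0 T, ∫ x in Ici 0, U t x = ∫ x in Ici 0, h x := fun t ht => by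
    rw [← humass t ht, integral_congr_ae (hUu t ht)]
  have hanti := hu.antitoneOn_tailMass hη.le hε hu0
  have htail : ∀ t ∈ Icc 0 T, tailMass ε (u t) = tailMass ε (U t) := fun t ht =>
    tailMass_congr hε.le (hUu t ht)
  refine ⟨U, ⟨hUm, hU0, fun t x hx => walkSum_le hε hh.nonneg hh.le (hτn t) hx,
    fun t ht => (L1.integrable_coeFn (u t)).congr (hUu t ht), hmass,
    fun s hs t ht hst => ?_, ?_, fun t ht R hR => ?_,
    fun φ φt φx φxx hφ => hu.weak hε hT hUm hU0 hUu (fun t ht => (hmass t ht).le) hφ⟩, hUu⟩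
  · simp only [← htail s hs, ← htail t ht]; exact hanti hs ht hst
  · intro t ht L hL hεL x hx hxL
    have hM0 : 0 ≤ M := (hh.nonneg 0).trans (hh.le 0)
    refine (walkSum_le_barrier hε hL hεL hM0 hh.nonneg hh.le (hτn t) hx hxL).trans ?_
    -- The speed $\tau'$ is nonincreasing, so $\tau(t)\ge t\,\tau'(t)$.
    have hlow : η / (3 * ε ^ 2) * t * tailMass ε (U t) ≤ τ t := by
      have hsub : Icc 0 t ⊆ Icc 0 T := Icc_subset_Icc_right ht.2
      have hmono := antitoneOn_of_hasDerivWithinAt_Icc (a := 0) (b := t)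
        (f := fun s => η / (3 * ε ^ 2) * tailMass ε (U t) * s - τ s)
        (fun s hs => ((hasDerivWithinAt_id s (Icc 0 t)).const_mul _).sub
          ((hτ s (hsub hs)).mono hsub)) (fun s hs => by
          have h1 : tailMass ε (U t) ≤ tailMass ε (semigroup J (τ s) F) := by
            have e : semigroup J (τ s) F = u s := hEq (hsub hs)
            rw [e, ← htail t ht]; exact hanti (hsub hs) ht hs.2
          have : 0 ≤ η / (3 * ε ^ 2) := by positivity
          nlinarith)
      have := hmono (left_mem_Icc.2 ht.1) (right_mem_Icc.2 ht.1) ht.1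
      simp only [hτ0, mul_zero, sub_zero] at this
      nlinarith
    gcongr
    linarith [Real.cos_le_one (ε / L)]
  · have := hu.setIntegral_Ici_le hη.le hε hT.le hu0 humass ht hR
    rw [integral_congr_ae (ae_mono (Measure.restrict_mono (Ici_subset_Ici.2 hR.le) le_rfl)
      (hUu t ht))] at this
    exact this

end

/-! ### Weak compactness and convergence of monotone functions. -/

/-- Bounded sequences in a separable Hilbert space have weakly convergent subsequences. -/
lemma exists_subseq_tendsto_inner {E : Type*} [NormedAddCommGroup E] [InnerProductSpace ℝ E]
    [CompleteSpace E] [TopologicalSpace.SeparableSpace E] (v : ℕ → E) (R : ℝ)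
    (hv : ∀ n, ‖v n‖ ≤ R) : ∃ (w : E) (σ : ℕ → ℕ), StrictMono σ ∧
      ∀ y, Tendsto (fun n => inner ℝ (v (σ n)) y) atTop (𝓝 (inner ℝ w y)) := by
  obtain ⟨w, -, σ, hσ, hw⟩ := WeakDual.isSeqCompact_closedBall ℝ E 0 R
    (x := fun n => StrongDual.toWeakDual (InnerProductSpace.toDual ℝ E (v n))) (fun n => by
      simpa using hv n)
  refine ⟨(InnerProductSpace.toDual ℝ E).symm (WeakDual.toStrongDual w), σ, hσ, fun y => ?_⟩
  have := ((WeakDual.eval_continuous y).tendsto w).comp hw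
  simpa [Function.comp_def] using this

section weak
variable {α : Type*} [MeasurableSpace α] {μ : Measure α}

lemma memLp_two_of_bounded {g : α → ℝ} {M : ℝ} (hi : Integrable g μ) (h0 : ∀ x, 0 ≤ g x)
    (hM : ∀ x, g x ≤ M) : MemLp g 2 μ := by
  rw [memLp_two_iff_integrable_sq hi.aestronglyMeasurable]
  refine (hi.const_mul M).mono' (hi.aestronglyMeasurable.pow 2) (ae_of_all _ fun x => ?_)
  rw [Real.norm_of_nonneg (sq_nonneg _), sq]
  exact mul_le_mul_of_nonneg_right (hM x) (h0 x)

/-- Nonnegative functions bounded in `L¹ ∩ L^∞` have a subsequence converging weakly in `L²`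
to a nonnegative integrable function. -/
lemma exists_subseq_tendsto_integral_mul [SigmaFinite μ] [IsSeparable μ] {g : ℕ → α → ℝ} {M C : ℝ}
    (hM0 : 0 ≤ M) (hi : ∀ n, Integrable (g n) μ) (h0 : ∀ n x, 0 ≤ g n x)
    (hM : ∀ n x, g n x ≤ M) (hC : ∀ n, ∫ x, g n x ∂μ ≤ C) :
    ∃ (σ : ℕ → ℕ) (f : α → ℝ), StrictMono σ ∧ Measurable f ∧ (∀ x, 0 ≤ f x) ∧ Integrable f μ ∧
      ∀ ψ : α → ℝ, MemLp ψ 2 μ →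
        Tendsto (fun n => ∫ x, g (σ n) x * ψ x ∂μ) atTop (𝓝 (∫ x, f x * ψ x ∂μ)) := by
  have hm : ∀ n, MemLp (g n) 2 μ := fun n => memLp_two_of_bounded (hi n) (h0 n) (hM n)
  -- Interpolation: $\|g\|_2^2\le\|g\|_\infty\|g\|_1$.
  have hnorm : ∀ n, ‖(hm n).toLp‖ ≤ √(M * C) := fun n => by
    refine Real.le_sqrt_of_sq_le ?_
    rw [← real_inner_self_eq_norm_sq, L2.inner_def]
    calc ∫ x, inner ℝ ((hm n).toLp (g n) x) ((hm n).toLp (g n) x) ∂μ = ∫ x, g n x * g n x ∂μ := by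
          refine integral_congr_ae ?_
          filter_upwards [(hm n).coeFn_toLp] with x hx
          rw [hx]; simp [sq]
      _ ≤ ∫ x, M * g n x ∂μ := by
          refine integral_mono_of_nonneg (ae_of_all _ fun x => mul_nonneg (h0 n x) (h0 n x))
            ((hi n).const_mul M) (ae_of_all _ fun x => ?_)
          exact mul_le_mul_of_nonneg_right (hM n x) (h0 n x)
      _ ≤ M * C := by
          rw [integral_const_mul]
          exact mul_le_mul_of_nonneg_left (hC n) hM0
  have : Fact ((2 : ℝ≥0∞) ≠ ∞) := ⟨by norm_num⟩
  have : TopologicalSpace.SeparableSpace (Lp ℝ 2 μ) :=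
    TopologicalSpace.SecondCountableTopology.to_separableSpace
  obtain ⟨w, σ, hσ, hw⟩ := exists_subseq_tendsto_inner (fun n => (hm n).toLp) _ hnorm
  have hconv : ∀ ψ : α → ℝ, MemLp ψ 2 μ →
      Tendsto (fun n => ∫ x, g (σ n) x * ψ x ∂μ) atTop (𝓝 (∫ x, w x * ψ x ∂μ)) := fun ψ hψ => by
    have := hw hψ.toLp
    simp only [L2.inner_def] at this
    convert this using 2 with n
    · refine integral_congr_ae ?_
      filter_upwards [(hm (σ n)).coeFn_toLp, hψ.coeFn_toLp] with x h1 h2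
      rw [h1, h2]; simp [mul_comm]
    · refine integral_congr_ae ?_
      filter_upwards [hψ.coeFn_toLp] with x h2
      rw [h2]; simp [mul_comm]
  have hset : ∀ s, MeasurableSet s → μ s < ∞ →
      Tendsto (fun n => ∫ x in s, g (σ n) x ∂μ) atTop (𝓝 (∫ x in s, w x ∂μ)) := fun s hs hμs => by
    have := hconv (s.indicator fun _ => 1) (memLp_indicator_const 2 hs 1 (Or.inr hμs.ne))
    have e : ∀ k : α → ℝ, ∫ x, k x * s.indicator (fun _ => (1 : ℝ)) x ∂μ = ∫ x in s, k x ∂μ :=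
      fun k => by
        rw [← integral_indicator hs]
        congr 1; ext x; by_cases hx : x ∈ s <;> simp [hx]
    simpa only [e] using this
  have hwint : ∀ s, MeasurableSet s → μ s < ∞ → IntegrableOn w s μ := fun s hs hμs => by
    have : IsFiniteMeasure (μ.restrict s) := ⟨by simpa using hμs⟩
    exact ((Lp.memLp w).restrict s).integrable (by norm_num)
  have hw0 : 0 ≤ᵐ[μ] w := ae_nonneg_of_forall_setIntegral_nonneg_of_sigmaFinite hwint
    fun s hs hμs => ge_of_tendsto' (hset s hs hμs) fun n => integral_nonneg (h0 _)
  have hcover : AECover μ atTop (spanningSets μ) :=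
    { ae_eventually_mem := ae_of_all _ fun x => by
        filter_upwards [eventually_ge_atTop (spanningSetsIndex μ x)] with n hn
        exact monotone_spanningSets μ hn (mem_spanningSetsIndex μ x)
      measurableSet := measurableSet_spanningSets μ }
  -- An $L^2$ limit need not be integrable on an infinite measure space; the bound $C$ passes to
  -- each set of finite measure and then to their union.
  have hwi : Integrable w μ := by
    refine hcover.integrable_of_integral_norm_bounded C (fun n =>
      hwint _ (measurableSet_spanningSets μ n) (measure_spanningSets_lt_top μ n))
      (Eventually.of_forall fun n => ?_)
    have e : ∫ x in spanningSets μ n, ‖w x‖ ∂μ = ∫ x in spanningSets μ n, w x ∂μ := by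
      refine integral_congr_ae ?_
      filter_upwards [ae_restrict_of_ae hw0] with x hx using Real.norm_of_nonneg hx
    rw [e]
    refine le_of_tendsto' (hset _ (measurableSet_spanningSets μ n)
      (measure_spanningSets_lt_top μ n)) fun k => ?_
    exact (setIntegral_le_integral (hi _) (ae_of_all _ (h0 _))).trans (hC _)
  have hfw : (fun x => max (w x) 0) =ᵐ[μ] w := by
    filter_upwards [hw0] with x hx using max_eq_left hx
  refine ⟨σ, fun x => max (w x) 0, hσ, (Lp.stronglyMeasurable w).measurable.max measurable_const,
    fun x => le_max_right _ _, hwi.congr hfw.symm, fun ψ hψ => ?_⟩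
  convert hconv ψ hψ using 2
  refine integral_congr_ae ?_
  filter_upwards [hfw] with x hx
  rw [hx]

end weak

/-- Exchange of limits: the truncation error `e R` is uniform in `n`. -/
lemma tendsto_of_approx {a : ℕ → ℝ} {b : ℕ → ℕ → ℝ} {c e : ℕ → ℝ} {l : ℝ}
    (hb : ∀ R, Tendsto (b R) atTop (𝓝 (c R))) (hc : Tendsto c atTop (𝓝 l))
    (he : Tendsto e atTop (𝓝 0)) (hab : ∀ R n, |a n - b R n| ≤ e R) :
    Tendsto a atTop (𝓝 l) := by
  rw [Metric.tendsto_atTop]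
  intro δ hδ
  obtain ⟨R, h1, h2⟩ := ((hc.eventually (Metric.ball_mem_nhds l (by positivity : 0 < δ / 3))).and
    (he.eventually (gt_mem_nhds (by positivity : 0 < δ / 3)))).exists
  obtain ⟨N, hN⟩ := Metric.tendsto_atTop.1 (hb R) (δ / 3) (by positivity)
  refine ⟨N, fun n hn => ?_⟩
  have h3 := hN n hn
  rw [Real.dist_eq] at h3 ⊢
  rw [Real.dist_eq] at h1
  have h4 := hab R n
  calc |a n - l| = |(a n - b R n) + (b R n - c R) + (c R - l)| := by ring_nf
    _ ≤ |a n - b R n| + |b R n - c R| + |c R - l| := abs_add_three _ _ _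
    _ < δ := by linarith

/-- Antitone functions whose integrals over intervals converge converge almost everywhere. -/
lemma ae_tendsto_of_antitoneOn {T : ℝ} {b : ℕ → ℝ → ℝ} {β : ℝ → ℝ} (hT : 0 < T)
    (hb : ∀ n, AntitoneOn (b n) (Icc 0 T)) (hβ : IntervalIntegrable β volume 0 T)
    (h : ∀ s ∈ Icc 0 T, ∀ t ∈ Icc 0 T, s ≤ t →
      Tendsto (fun n => ∫ r in s..t, b n r) atTop (𝓝 (∫ r in s..t, β r))) :
    ∀ᵐ t ∂(volume.restrict (Icc 0 T)), Tendsto (fun n => b n t) atTop (𝓝 (β t)) := by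
  rw [← Measure.restrict_congr_set (Ioo_ae_eq_Icc (μ := volume) (a := (0 : ℝ)) (b := T))]
  filter_upwards [ae_restrict_of_ae hβ.ae_hasDerivAt_integral, ae_restrict_mem measurableSet_Ioo]
    with t hd ht
  have htI : t ∈ Icc 0 T := Ioo_subset_Icc_self ht
  have hu : uIcc 0 T = Icc 0 T := uIcc_of_le hT.le
  have h0 : (0 : ℝ) ∈ Icc 0 T := ⟨le_rfl, hT.le⟩
  -- At a Lebesgue differentiation point, averages of $\beta$ over short intervals on either side
  -- are close to $\beta(t)$. Monotonicity squeezes $b_n(t)$ between its right average and its left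
  -- average, and these converge.
  have hslope := hasDerivAt_iff_tendsto_slope.1 (hd (hu ▸ htI) 0 (hu ▸ h0))
  have hbi : ∀ n, ∀ s ∈ Icc 0 T, ∀ r ∈ Icc 0 T, IntervalIntegrable (b n) volume s r :=
    fun n s hs r hr => ((hb n).mono (uIcc_subset_Icc hs hr)).intervalIntegrable
  have hβi : ∀ s ∈ Icc 0 T, IntervalIntegrable β volume 0 s := fun s hs =>
    hβ.mono_set (by rw [uIcc_of_le hs.1, hu]; exact Icc_subset_Icc_right hs.2)
  have hsl : ∀ s ∈ Icc 0 T, slope (fun x => ∫ r in 0..x, β r) t s = (∫ r in t..s, β r) / (s - t) :=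
    fun s hs => by
      rw [slope_def_field, intervalIntegral.integral_interval_sub_left (hβi s hs) (hβi t htI)]
  rw [Metric.tendsto_nhds]
  intro δ hδ
  have hev := hslope.eventually (Metric.ball_mem_nhds (β t) hδ)
  obtain ⟨s, hsT, hs⟩ : ∃ s ∈ Ioo t T, slope (fun x => ∫ r in 0..x, β r) t s
      ∈ Metric.ball (β t) δ := by
    have h1 := hev.filter_mono (nhdsWithin_mono t (fun x (hx : t < x) => ne_of_gt hx))
    exact (Filter.Eventually.and (Ioo_mem_nhdsGT ht.2) h1).exists
  obtain ⟨r, hrT, hr⟩ : ∃ r ∈ Ioo 0 t, slope (fun x => ∫ r in 0..x, β r) t r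
      ∈ Metric.ball (β t) δ := by
    have h1 := hev.filter_mono (nhdsWithin_mono t (fun x (hx : x < t) => ne_of_lt hx))
    exact (Filter.Eventually.and (Ioo_mem_nhdsLT ht.1) h1).exists
  have hsI : s ∈ Icc 0 T := ⟨ht.1.le.trans hsT.1.le, hsT.2.le⟩
  have hrI : r ∈ Icc 0 T := ⟨hrT.1.le, hrT.2.le.trans ht.2.le⟩
  rw [hsl s hsI, Metric.mem_ball, Real.dist_eq, abs_lt] at hs
  rw [hsl r hrI, Metric.mem_ball, Real.dist_eq, abs_lt] at hr
  have hst : 0 < s - t := sub_pos.2 hsT.1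
  have htr : 0 < t - r := sub_pos.2 hrT.2
  have hs' : (β t - δ) * (s - t) < ∫ x in t..s, β x := by
    rw [← lt_div_iff₀ hst]; linarith
  have hr' : ∫ x in r..t, β x < (β t + δ) * (t - r) := by
    rw [← div_lt_iff₀ htr]
    have : (∫ x in t..r, β x) / (r - t) = (∫ x in r..t, β x) / (t - r) := by
      rw [intervalIntegral.integral_symm, ← neg_sub t r, neg_div_neg_eq]
    linarith
  filter_upwards [(h t htI s hsI hsT.1.le).eventually (lt_mem_nhds hs'),
    (h r hrI t htI hrT.2.le).eventually (gt_mem_nhds hr')] with n h1 h2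
  have e1 : ∫ x in t..s, b n x ≤ b n t * (s - t) := by
    have := intervalIntegral.integral_mono_on hsT.1.le (hbi n t htI s hsI)
      (intervalIntegrable_const (c := b n t))
      (fun x hx => hb n htI ⟨htI.1.trans hx.1, hx.2.trans hsI.2⟩ hx.1)
    rwa [intervalIntegral.integral_const, smul_eq_mul, mul_comm] at this
  have e2 : b n t * (t - r) ≤ ∫ x in r..t, b n x := by
    have := intervalIntegral.integral_mono_on hrT.2.le (intervalIntegrable_const (c := b n t))
      (hbi n r hrI t htI)
      (fun x hx => hb n ⟨hrI.1.trans hx.1, hx.2.trans htI.2⟩ htI hx.2)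
    rwa [intervalIntegral.integral_const, smul_eq_mul, mul_comm] at this
  rw [Real.dist_eq, abs_lt]
  have k1 := lt_of_mul_lt_mul_right (h1.trans_le e1) hst.le
  have k2 := lt_of_mul_lt_mul_right (e2.trans_lt h2) htr.le
  constructor <;> linarith

/-- The second difference is `ε²` times a value of the second derivative. -/
lemma exists_secondDiff_eq {T : ℝ} {φ φt φx φxx : ℝ → ℝ → ℝ} (hφ : IsTestFunction T φ φt φx φxx)
    {t x ε : ℝ} (ht : t ∈ Icc 0 T) (hε : 0 < ε) (hx : ε ≤ x) :
    ∃ ξ ∈ Icc (x - ε) (x + ε), 0 ≤ ξ ∧ secondDiff ε φ t x = ε ^ 2 * φxx t ξ := by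
  have hat : ∀ {k k' : ℝ → ℝ}, (∀ y ∈ Ici (0 : ℝ), HasDerivWithinAt k (k' y) (Ici 0) y) →
      ∀ y, 0 < y → HasDerivAt k (k' y) y := fun hk y hy =>
    (hk y (mem_Ici.2 hy.le)).hasDerivAt (Ici_mem_nhds hy)
  have hd := hat (hφ.hasDeriv_x t ht)
  have hdd := hat (hφ.hasDeriv_xx t ht)
  have hc : ContinuousOn (φ t) (Ici 0) := fun y hy => (hφ.hasDeriv_x t ht y hy).continuousWithinAt
  -- Cauchy's mean value theorem in the step length, against $s^2$, followed by the ordinary one for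
  -- $\partial_x\varphi$ on $[x-c,x+c]$; the factors $2c$ cancel. No derivative beyond the second is
  -- used.
  obtain ⟨c, hcI, hce⟩ := exists_ratio_hasDerivAt_eq_ratio_slope
    (fun s => φ t (x + s) + φ t (x - s) - 2 * φ t x) (fun s => φx t (x + s) - φx t (x - s)) hε
    (((hc.comp (by fun_prop) fun s hs => mem_Ici.2 (by linarith [hs.1])).add
      (hc.comp (by fun_prop) fun s hs => mem_Ici.2 (by linarith [hs.2]))).sub continuousOn_const)
    (fun s hs => by
      have h1 := (hd (x + s) (by linarith [hs.1])).comp_const_add x s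
      have h2 := (hd (x - s) (by linarith [hs.2])).comp_const_sub x s
      simpa [sub_eq_add_neg] using (h1.add h2).sub_const (2 * φ t x))
    (fun s => s ^ 2) (fun s => 2 * s) (by fun_prop)
    (fun s _ => by simpa using hasDerivAt_pow 2 s)
  obtain ⟨ξ, hξI, hξe⟩ := exists_hasDerivAt_eq_slope (φx t) (φxx t)
    (show x - c < x + c by linarith [hcI.1])
    (fun y hy => (hφ.hasDeriv_xx t ht y (mem_Ici.2 (by linarith [hy.1, hcI.2]))).continuousWithinAt.mono
      fun z hz => mem_Ici.2 (by linarith [hz.1, hcI.2]))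
    (fun y hy => hdd y (by linarith [hy.1, hcI.2]))
  have hc0 := hcI.1
  refine ⟨ξ, ⟨by linarith [hξI.1, hcI.2], by linarith [hξI.2, hcI.2]⟩,
    by linarith [hξI.1, hcI.2], ?_⟩
  have hx' : x ∈ Ici ε := hx
  simp only [secondDiff, indicator, hx', if_true]
  rw [eq_div_iff (by linarith)] at hξe
  simp only [add_zero, sub_zero] at hce
  have : 2 * c ≠ 0 := by positivity
  apply mul_right_cancel₀ this
  nlinarith

/-! ### Truncated profiles and their tails. -/

/-- The part of a profile carried by `x ≥ ε`. -/
noncomputable def cut (ε : ℝ) (U : ℝ → ℝ → ℝ) (p : ℝ × ℝ) : ℝ := (Ici ε).indicator (U p.1) p.2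

/-- The bound for the mass beyond `R`. -/
noncomputable def tailBound (η T : ℝ) (h : ℝ → ℝ) (R : ℝ) : ℝ :=
  (∫ x in Ici 0, h x * min (x ^ 2 / R ^ 2) 1) + 2 * η * (∫ x in Ici 0, h x) ^ 2 * T / (3 * R ^ 2)

section tail
variable {η T M : ℝ} {h : ℝ → ℝ}

lemma tendsto_natCast_add_one_sq_inv : Tendsto (fun k : ℕ => (((k : ℝ) + 1) ^ 2)⁻¹) atTop (𝓝 0) :=
  ((tendsto_pow_atTop two_ne_zero).comp
    (tendsto_atTop_add_const_right _ 1 tendsto_natCast_atTop_atTop)).inv_tendsto_atTop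

lemma tendsto_tailBound (hh : IsDatum M h) :
    Tendsto (fun k : ℕ => tailBound η T h (k + 1)) atTop (𝓝 0) := by
  have hsq := tendsto_natCast_add_one_sq_inv
  have h1 : Tendsto (fun k : ℕ => ∫ x in Ici 0, h x * min (x ^ 2 / ((k : ℝ) + 1) ^ 2) 1) atTop
      (𝓝 (∫ x in Ici (0 : ℝ), (0 : ℝ))) := by
    refine tendsto_integral_of_dominated_convergence h (fun k => ?_) hh.integrable
      (fun k => ae_of_all _ fun x => ?_) (ae_of_all _ fun x => ?_)
    · refine hh.integrable.aestronglyMeasurable.mul ?_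
      exact (by fun_prop : Continuous fun x : ℝ => min (x ^ 2 / ((k : ℝ) + 1) ^ 2) 1).aestronglyMeasurable
    · have h2 : 0 ≤ min (x ^ 2 / ((k : ℝ) + 1) ^ 2) 1 := le_min (by positivity) zero_le_one
      rw [Real.norm_of_nonneg (mul_nonneg (hh.nonneg x) h2)]
      exact mul_le_of_le_one_right (hh.nonneg x) (min_le_right _ _)
    · have h3 : Tendsto (fun k : ℕ => x ^ 2 / ((k : ℝ) + 1) ^ 2) atTop (𝓝 0) := by
        simpa [div_eq_mul_inv] using hsq.const_mul (x ^ 2)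
      have h4 := (h3.min (tendsto_const_nhds (x := (1 : ℝ)))).const_mul (h x)
      simpa using h4
  have h2 := hsq.const_mul (2 * η * (∫ x in Ici 0, h x) ^ 2 * T / 3)
  have h3 := h1.add h2
  simp only [integral_zero, mul_zero, add_zero] at h3
  refine h3.congr fun k => ?_
  unfold tailBound
  congr 1
  field_simp

end tail

section cut
variable {η T ε M : ℝ} {h : ℝ → ℝ} {U : ℝ → ℝ → ℝ}

lemma IsProfile.measurable_cut (hU : IsProfile η T ε M h U) : Measurable (cut ε U) := by
  have : cut ε U = (Prod.snd ⁻¹' (Ici ε)).indicator (Function.uncurry U) := by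
    ext p; simp [cut, indicator, Function.uncurry]
  rw [this]
  exact hU.measurable.indicator (measurable_snd measurableSet_Ici)

lemma IsProfile.cut_nonneg (hU : IsProfile η T ε M h U) (p : ℝ × ℝ) : 0 ≤ cut ε U p :=
  indicator_nonneg (fun x _ => hU.nonneg p.1 x) _

lemma IsProfile.cut_le_self (hU : IsProfile η T ε M h U) (p : ℝ × ℝ) : cut ε U p ≤ U p.1 p.2 :=
  indicator_le_self' (fun x _ => hU.nonneg p.1 x) _

lemma IsProfile.cut_le (hU : IsProfile η T ε M h U) (hM : 0 ≤ M) (p : ℝ × ℝ) : cut ε U p ≤ M := by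
  simp only [cut, indicator]
  split_ifs with hx
  · exact hU.le _ _ hx
  · exact hM

lemma IsProfile.integrable_uncurry (hU : IsProfile η T ε M h U) :
    Integrable (Function.uncurry U) (strip T) :=
  integrable_strip hU.measurable hU.nonneg hU.integrable (fun t ht => (hU.mass_eq t ht).le)

lemma IsProfile.integrable_cut (hU : IsProfile η T ε M h U) : Integrable (cut ε U) (strip T) := by
  refine hU.integrable_uncurry.mono' hU.measurable_cut.aestronglyMeasurable (ae_of_all _ fun p => ?_)
  rw [Real.norm_of_nonneg (hU.cut_nonneg p)]
  exact hU.cut_le_self p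

lemma integral_cut (hε : 0 ≤ ε) (t : ℝ) : ∫ x in Ici 0, cut ε U (t, x) = tailMass ε (U t) :=
  setIntegral_halfLine_indicator hε (U t)

lemma IsProfile.tailMass_le (hU : IsProfile η T ε M h U) (hε : 0 ≤ ε) {t : ℝ} (ht : t ∈ Icc 0 T) :
    tailMass ε (U t) ≤ ∫ x in Ici 0, h x := by
  rw [← hU.mass_eq t ht]
  exact setIntegral_mono_set (hU.integrable t ht) (ae_of_all _ (hU.nonneg t))
    (Ici_subset_Ici.2 hε).eventuallyLE

lemma IsProfile.tailMass_nonneg (hU : IsProfile η T ε M h U) (t : ℝ) : 0 ≤ tailMass ε (U t) :=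
  integral_nonneg (hU.nonneg t)

lemma IsProfile.measurable_tailMass (hU : IsProfile η T ε M h U) :
    Measurable fun t => tailMass ε (U t) :=
  (hU.measurable.stronglyMeasurable.integral_prod_right (ν := volume.restrict (Ici ε))).measurable

lemma IsProfile.setIntegral_cut_le (hU : IsProfile η T ε M h U) (hT : 0 ≤ T) {R : ℝ} (hR : 0 < R) :
    ∫ p in {p : ℝ × ℝ | R ≤ p.2}, cut ε U p ∂strip T ≤ T * tailBound η T h R := by
  have hS : MeasurableSet {p : ℝ × ℝ | R ≤ p.2} := measurableSet_le measurable_const measurable_snd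
  have hi : Integrable ({p : ℝ × ℝ | R ≤ p.2}.indicator (cut ε U)) (strip T) :=
    hU.integrable_cut.indicator hS
  rw [← integral_indicator hS, strip, integral_prod _ hi]
  calc ∫ t in Icc 0 T, ∫ x in Ici 0, {p : ℝ × ℝ | R ≤ p.2}.indicator (cut ε U) (t, x)
      ≤ ∫ t in Icc 0 T, tailBound η T h R := by
        refine integral_mono_ae hi.integral_prod_left (integrable_const _) ?_
        filter_upwards [ae_restrict_mem measurableSet_Icc] with t ht
        refine le_trans ?_ (hU.tight t ht R hR)
        rw [← setIntegral_halfLine_indicator hR.le]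
        refine integral_mono_of_nonneg (ae_of_all _ fun x =>
          indicator_nonneg (fun p _ => hU.cut_nonneg p) _)
          ((integrable_halfLine_indicator hR.le).2
            ((hU.integrable t ht).mono_measure
              (Measure.restrict_mono (Ici_subset_Ici.2 hR.le) le_rfl))) (ae_of_all _ fun x => ?_)
        simp only [indicator, mem_ofPred_eq, mem_Ici]
        split_ifs
        · exact hU.cut_le_self (t, x)
        · exact le_rfl
    _ = T * tailBound η T h R := by
        rw [setIntegral_const, smul_eq_mul]
        simp [hT]

end cut

/-! ### Passage to the limit. -/

/-- The truncations of the profiles `U n` converge weakly in `L²` to `f`. -/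
structure IsWeakLimit (η T M : ℝ) (h : ℝ → ℝ) (ε : ℕ → ℝ) (U : ℕ → ℝ → ℝ → ℝ)
    (f : ℝ → ℝ → ℝ) : Prop where
  η_pos : 0 < η
  T_pos : 0 < T
  datum : IsDatum M h
  ε_pos : ∀ n, 0 < ε n
  ε_lim : Tendsto ε atTop (𝓝 0)
  profile : ∀ n, IsProfile η T (ε n) M h (U n)
  measurable : Measurable (Function.uncurry f)
  nonneg : ∀ t x, 0 ≤ f t x
  integrable : Integrable (Function.uncurry f) (strip T)
  weak : ∀ ψ : ℝ × ℝ → ℝ, MemLp ψ 2 (strip T) →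
    Tendsto (fun n => ∫ p, cut (ε n) (U n) p * ψ p ∂strip T) atTop
      (𝓝 (∫ p, f p.1 p.2 * ψ p ∂strip T))

lemma IsDatum.bound_nonneg {M : ℝ} {h : ℝ → ℝ} (hh : IsDatum M h) : 0 ≤ M :=
  (hh.nonneg 0).trans (hh.le 0)

lemma exists_isWeakLimit {η T M : ℝ} {h : ℝ → ℝ} {ε : ℕ → ℝ} {U : ℕ → ℝ → ℝ → ℝ}
    (hη : 0 < η) (hT : 0 < T) (hh : IsDatum M h) (hε : ∀ n, 0 < ε n)
    (hε0 : Tendsto ε atTop (𝓝 0)) (hU : ∀ n, IsProfile η T (ε n) M h (U n)) :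
    ∃ (σ : ℕ → ℕ) (f : ℝ → ℝ → ℝ), StrictMono σ ∧
      IsWeakLimit η T M h (ε ∘ σ) (U ∘ σ) f := by
  obtain ⟨σ, f, hσ, hfm, hf0, hfi, hf⟩ := exists_subseq_tendsto_integral_mul (μ := strip T)
    (g := fun n => cut (ε n) (U n)) (C := T * ∫ x in Ici 0, h x) hh.bound_nonneg
    (fun n => (hU n).integrable_cut) (fun n => (hU n).cut_nonneg)
    (fun n => (hU n).cut_le hh.bound_nonneg) (fun n => by
      rw [strip, integral_prod _ (hU n).integrable_cut]
      calc ∫ t in Icc 0 T, ∫ x in Ici 0, cut (ε n) (U n) (t, x)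
          ≤ ∫ t in Icc 0 T, ∫ x in Ici 0, h x := by
            refine integral_mono_ae (hU n).integrable_cut.integral_prod_left (integrable_const _) ?_
            filter_upwards [ae_restrict_mem measurableSet_Icc] with t ht
            rw [integral_cut (hε n).le]
            exact (hU n).tailMass_le (hε n).le ht
        _ = _ := by rw [setIntegral_const, smul_eq_mul]; simp [hT.le])
  exact ⟨σ, fun t x => f (t, x), hσ, hη, hT, hh, fun n => hε _, hε0.comp hσ.tendsto_atTop,
    fun n => hU _, hfm, fun t x => hf0 _, hfi, hf⟩

section limit
variable {η T M : ℝ} {h : ℝ → ℝ} {ε : ℕ → ℝ} {U : ℕ → ℝ → ℝ → ℝ} {f : ℝ → ℝ → ℝ}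

lemma strip_lt_top (R : ℝ) : strip T {p : ℝ × ℝ | p.2 < R} < ∞ := by
  have : {p : ℝ × ℝ | p.2 < R} = univ ×ˢ Iio R := by ext p; simp
  rw [this, strip, Measure.prod_prod]
  refine ENNReal.mul_lt_top (by simp) ?_
  rw [halfLine, Measure.restrict_apply measurableSet_Iio, Iio_inter_Ici]
  simp

/-- Weak convergence tested against bounded functions converging almost everywhere. -/
lemma IsWeakLimit.tendsto (hf : IsWeakLimit η T M h ε U f) {ψ : ℕ → ℝ × ℝ → ℝ}
    {ψ' : ℝ × ℝ → ℝ} {C : ℝ} (hC0 : 0 ≤ C)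
    (hm : ∀ n, AEStronglyMeasurable (ψ n) (strip T))
    (hC : ∀ n, ∀ᵐ p ∂strip T, |ψ n p| ≤ C)
    (hψ : ∀ᵐ p ∂strip T, Tendsto (fun n => ψ n p) atTop (𝓝 (ψ' p))) :
    Tendsto (fun n => ∫ p, cut (ε n) (U n) p * ψ n p ∂strip T) atTop
      (𝓝 (∫ p, f p.1 p.2 * ψ' p ∂strip T)) := by
  have hm' : AEStronglyMeasurable ψ' (strip T) := aestronglyMeasurable_of_tendsto_ae atTop hm hψ
  have hC' : ∀ᵐ p ∂strip T, |ψ' p| ≤ C := by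
    filter_upwards [hψ, ae_all_iff.2 hC] with p h1 h2
    exact le_of_tendsto' h1.abs h2
  have hM0 := hf.datum.bound_nonneg
  set S : ℕ → Set (ℝ × ℝ) := fun R => {p | p.2 < (R : ℝ) + 1} with hS
  have hSm : ∀ R, MeasurableSet (S R) := fun R => measurableSet_lt measurable_snd measurable_const
  have hSfin : ∀ R, IsFiniteMeasure ((strip T).restrict (S R)) := fun R =>
    ⟨by rw [Measure.restrict_apply_univ]; exact strip_lt_top _⟩
  have hicut : ∀ n, Integrable (cut (ε n) (U n)) (strip T) := fun n => (hf.profile n).integrable_cut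
  have hi : ∀ n, Integrable (fun p => cut (ε n) (U n) p * ψ n p) (strip T) := fun n =>
    (hicut n).mul_bdd (hm n) (hC n)
  -- A bounded function need not lie in $L^2$ of the strip, so the test is cut at $x<R+1$, where the
  -- measure is finite; tightness bounds the discarded part uniformly in `n`.
  refine tendsto_of_approx (b := fun R n => ∫ p in S R, cut (ε n) (U n) p * ψ n p ∂strip T)
    (c := fun R => ∫ p in S R, f p.1 p.2 * ψ' p ∂strip T)
    (e := fun R => C * (T * tailBound η T h (R + 1))) (fun R => ?_) ?_ ?_ fun R n => ?_
  · have h1 := hf.weak ((S R).indicator ψ') ((memLp_indicator_iff_restrict (hSm R)).2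
      (MemLp.of_bound hm'.restrict C (ae_restrict_of_ae hC')))
    have e : ∀ k : ℝ × ℝ → ℝ, ∫ p, k p * (S R).indicator ψ' p ∂strip T
        = ∫ p in S R, k p * ψ' p ∂strip T := fun k => by
      rw [← integral_indicator (hSm R)]
      congr 1; ext p; simp only [indicator]; split_ifs <;> simp
    simp only [e] at h1
    -- The uniform bound $M$ on the truncated profiles lets dominated convergence absorb the change
    -- of test function.
    have h2 : Tendsto (fun n => ∫ p in S R, cut (ε n) (U n) p * (ψ n p - ψ' p) ∂strip T) atTop
        (𝓝 0) := by
      have h3 : Tendsto (fun n => ∫ p in S R, M * |ψ n p - ψ' p| ∂strip T) atTop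
          (𝓝 (∫ p in S R, (0 : ℝ) ∂strip T)) := by
        refine tendsto_integral_of_dominated_convergence (fun _ => M * (2 * C)) (fun n => ?_)
          (integrable_const _) (fun n => ?_) ?_
        · exact ((((hm n).sub hm').norm).const_mul M).restrict
        · filter_upwards [ae_restrict_of_ae (hC n), ae_restrict_of_ae hC'] with p a1 a2
          rw [norm_mul, Real.norm_of_nonneg hM0, Real.norm_eq_abs, abs_abs]
          gcongr
          calc |ψ n p - ψ' p| ≤ |ψ n p| + |ψ' p| := abs_sub _ _
            _ ≤ 2 * C := by linarith
        · filter_upwards [ae_restrict_of_ae hψ] with p hp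
          have := ((hp.sub_const (ψ' p)).abs).const_mul M
          simpa using this
      rw [integral_zero] at h3
      refine squeeze_zero_norm (fun n => ?_) h3
      refine norm_integral_le_of_norm_le ?_ (ae_of_all _ fun p => ?_)
      · refine Integrable.const_mul (Integrable.of_bound ((hm n).sub hm').norm.restrict (2 * C) ?_) M
        filter_upwards [ae_restrict_of_ae (hC n), ae_restrict_of_ae hC'] with p a1 a2
        rw [norm_norm]
        calc |ψ n p - ψ' p| ≤ |ψ n p| + |ψ' p| := abs_sub _ _
          _ ≤ 2 * C := by linarith
      · rw [norm_mul, Real.norm_of_nonneg ((hf.profile n).cut_nonneg p), Real.norm_eq_abs]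
        exact mul_le_mul_of_nonneg_right ((hf.profile n).cut_le hM0 p) (abs_nonneg _)
    have h4 := h1.add h2
    rw [add_zero] at h4
    refine h4.congr fun n => ?_
    have i1 : Integrable (fun p => cut (ε n) (U n) p * ψ' p) (strip T) :=
      (hicut n).mul_bdd hm' hC'
    have i2 : Integrable (fun p => cut (ε n) (U n) p * (ψ n p - ψ' p)) (strip T) :=
      ((hi n).sub i1).congr (ae_of_all _ fun p => by simp only [Pi.sub_apply]; ring)
    rw [← integral_add i1.integrableOn i2.integrableOn]
    congr 1; ext p; ring
  · have hfi : Integrable (fun p : ℝ × ℝ => f p.1 p.2 * ψ' p) (strip T) :=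
      hf.integrable.mul_bdd hm' hC'
    simp only [← integral_indicator (hSm _)]
    refine tendsto_integral_of_dominated_convergence (fun p => ‖f p.1 p.2 * ψ' p‖) (fun R => ?_)
      hfi.norm (fun R => ae_of_all _ fun p => norm_indicator_le_norm_self _ _)
      (ae_of_all _ fun p => ?_)
    · exact hfi.aestronglyMeasurable.indicator (hSm R)
    · refine tendsto_const_nhds.congr' ?_
      obtain ⟨N, hN⟩ := exists_nat_gt p.2
      filter_upwards [eventually_ge_atTop N] with R hR
      have : p ∈ S R := by
        have : (N : ℝ) ≤ R := by exact_mod_cast hR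
        simp only [hS, mem_ofPred_eq]; linarith
      rw [indicator_of_mem this]
  · simpa using ((tendsto_tailBound hf.datum).const_mul T).const_mul C
  · have hsplit := integral_add_compl (hSm R) (hi n)
    have : ∫ p, cut (ε n) (U n) p * ψ n p ∂strip T - ∫ p in S R, cut (ε n) (U n) p * ψ n p ∂strip T
        = ∫ p in (S R)ᶜ, cut (ε n) (U n) p * ψ n p ∂strip T := by linarith
    rw [this]
    have hcompl : (S R)ᶜ = {p : ℝ × ℝ | (R : ℝ) + 1 ≤ p.2} := by ext p; simp [hS]
    rw [hcompl]
    have hle : |∫ p in {p : ℝ × ℝ | (R : ℝ) + 1 ≤ p.2}, cut (ε n) (U n) p * ψ n p ∂strip T|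
        ≤ ∫ p in {p : ℝ × ℝ | (R : ℝ) + 1 ≤ p.2}, C * cut (ε n) (U n) p ∂strip T := by
      rw [← Real.norm_eq_abs]
      refine norm_integral_le_of_norm_le ((hicut n).const_mul C).integrableOn ?_
      filter_upwards [ae_restrict_of_ae (hC n)] with p hp
      rw [norm_mul, Real.norm_of_nonneg ((hf.profile n).cut_nonneg p), mul_comm]
      exact mul_le_mul_of_nonneg_right hp ((hf.profile n).cut_nonneg p)
    refine hle.trans ?_
    rw [integral_const_mul]
    have hset := (hf.profile n).setIntegral_cut_le hf.T_pos.le (R := (R : ℝ) + 1) (by positivity)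
    exact mul_le_mul_of_nonneg_left hset hC0

end limit

section limit
variable {η T M : ℝ} {h : ℝ → ℝ} {ε : ℕ → ℝ} {U : ℕ → ℝ → ℝ → ℝ} {f : ℝ → ℝ → ℝ}

lemma integral_strip_mul_indicator {k : ℝ × ℝ → ℝ} (hk : Integrable k (strip T)) {s t : ℝ}
    (hs : 0 ≤ s) (hst : s ≤ t) (ht : t ≤ T) :
    ∫ p, k p * (Prod.fst ⁻¹' Ioc s t).indicator (fun _ => (1 : ℝ)) p ∂strip T
      = ∫ r in s..t, ∫ x in Ici 0, k (r, x) := by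
  have hsub : Ioc s t ⊆ Icc 0 T := fun r hr => ⟨hs.trans hr.1.le, hr.2.trans ht⟩
  have hS : MeasurableSet (Prod.fst ⁻¹' Ioc s t : Set (ℝ × ℝ)) := measurable_fst measurableSet_Ioc
  have e : ∀ p, k p * (Prod.fst ⁻¹' Ioc s t).indicator (fun _ => (1 : ℝ)) p
      = (Prod.fst ⁻¹' Ioc s t).indicator k p := fun p => by
    simp only [indicator]; split_ifs <;> simp
  simp only [e]
  rw [strip, integral_prod _ (hk.indicator hS), intervalIntegral.integral_of_le hst]
  have e2 : ∀ r, ∫ x in Ici 0, (Prod.fst ⁻¹' Ioc s t).indicator k (r, x)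
      = (Ioc s t).indicator (fun r => ∫ x in Ici 0, k (r, x)) r := fun r => by
    by_cases hr : r ∈ Ioc s t
    · rw [indicator_of_mem hr]
      congr 1; ext x
      exact indicator_of_mem (show (r, x) ∈ Prod.fst ⁻¹' Ioc s t from hr) k
    · rw [indicator_of_notMem hr]
      refine (integral_congr_ae (ae_of_all _ fun x => ?_)).trans (integral_zero _ _)
      exact indicator_of_notMem (a := ((r, x) : ℝ × ℝ)) (fun hmem => hr hmem) k
  simp only [e2]
  rw [integral_indicator measurableSet_Ioc, Measure.restrict_restrict measurableSet_Ioc,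
    inter_eq_left.2 hsub]

lemma IsWeakLimit.integrable_mass (hf : IsWeakLimit η T M h ε U f) :
    Integrable (mass f) (volume.restrict (Icc 0 T)) := hf.integrable.integral_prod_left

lemma IsWeakLimit.mass_nonneg (hf : IsWeakLimit η T M h ε U f) (t : ℝ) : 0 ≤ mass f t :=
  integral_nonneg (hf.nonneg t)

/-- The strong convergence behind the nonlinear limit. Testing against the indicator of a time
interval, constant in $x$, gives convergence of the integrals of the tail masses; their monotonicity
does the rest. -/
lemma IsWeakLimit.ae_tendsto_tailMass (hf : IsWeakLimit η T M h ε U f) :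
    ∀ᵐ t ∂(volume.restrict (Icc 0 T)),
      Tendsto (fun n => tailMass (ε n) (U n t)) atTop (𝓝 (mass f t)) := by
  refine ae_tendsto_of_antitoneOn hf.T_pos (fun n => (hf.profile n).antitone)
    ((intervalIntegrable_iff_integrableOn_Icc_of_le hf.T_pos.le).2 hf.integrable_mass) ?_
  intro s hs t ht hst
  have hS : MeasurableSet (Prod.fst ⁻¹' Ioc s t : Set (ℝ × ℝ)) := measurable_fst measurableSet_Ioc
  have h1 := hf.tendsto (ψ := fun _ => (Prod.fst ⁻¹' Ioc s t).indicator (fun _ => (1 : ℝ)))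
    zero_le_one (fun _ => (measurable_const.indicator hS).aestronglyMeasurable)
    (fun _ => ae_of_all _ fun p => by simp only [indicator]; split_ifs <;> simp)
    (ae_of_all _ fun p => tendsto_const_nhds)
  have h2 := integral_strip_mul_indicator (k := fun p => f p.1 p.2) hf.integrable hs.1 hst ht.2
  rw [h2] at h1
  refine h1.congr fun n => ?_
  rw [integral_strip_mul_indicator (hf.profile n).integrable_cut hs.1 hst ht.2]
  simp only [integral_cut (hf.ε_pos n).le]

lemma IsWeakLimit.ae_mass_le (hf : IsWeakLimit η T M h ε U f) :
    ∀ᵐ t ∂(volume.restrict (Icc 0 T)), mass f t ≤ ∫ x in Ici 0, h x := by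
  filter_upwards [hf.ae_tendsto_tailMass, ae_restrict_mem measurableSet_Icc] with t h1 ht
  exact le_of_tendsto' h1 fun n => (hf.profile n).tailMass_le (hf.ε_pos n).le ht

lemma IsWeakLimit.ae_integrable_slice (hf : IsWeakLimit η T M h ε U f) :
    ∀ᵐ t ∂(volume.restrict (Icc 0 T)), Integrable (f t) halfLine :=
  hf.integrable.prod_right_ae

lemma IsWeakLimit.mass_bound_nonneg (hf : IsWeakLimit η T M h ε U f) : 0 ≤ ∫ x in Ici 0, h x :=
  integral_nonneg hf.datum.nonneg

/-- Weak convergence of the full solutions, including the mass trapped at the origin. -/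
lemma IsWeakLimit.tendsto_full (hf : IsWeakLimit η T M h ε U f) {ψ : ℝ → ℝ → ℝ} {C : ℝ}
    (hψ : ContinuousOn (Function.uncurry ψ) (Icc 0 T ×ˢ Ici 0))
    (hC : ∀ t ∈ Icc 0 T, ∀ x ∈ Ici (0 : ℝ), |ψ t x| ≤ C) :
    Tendsto (fun n => ∫ t in Icc 0 T, ∫ x in Ici 0, U n t x * ψ t x) atTop
      (𝓝 ((∫ t in Icc 0 T, ∫ x in Ici 0, f t x * ψ t x)
        + ∫ t in Icc 0 T, ((∫ x in Ici 0, h x) - mass f t) * ψ t 0)) := by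
  set ρ := ∫ x in Ici 0, h x with hρ
  have hρ0 : 0 ≤ ρ := hf.mass_bound_nonneg
  have h0T : (0 : ℝ) ∈ Icc 0 T := ⟨le_rfl, hf.T_pos.le⟩
  have hC0 : 0 ≤ C := (abs_nonneg _).trans (hC 0 h0T 0 (mem_Ici.2 le_rfl))
  have hψm := aestronglyMeasurable_strip hψ
  have hψC : ∀ᵐ p ∂strip T, |Function.uncurry ψ p| ≤ C := by
    filter_upwards [ae_strip_mem T] with p hp using hC _ hp.1 _ hp.2
  have h1 := hf.tendsto (ψ := fun _ => Function.uncurry ψ) hC0 (fun _ => hψm) (fun _ => hψC)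
    (ae_of_all _ fun p => tendsto_const_nhds)
  have hif : Integrable (fun p : ℝ × ℝ => f p.1 p.2 * Function.uncurry ψ p) (strip T) :=
    hf.integrable.mul_bdd hψm hψC
  have hic : ∀ n, Integrable (fun p : ℝ × ℝ => cut (ε n) (U n) p * Function.uncurry ψ p)
      (strip T) := fun n => (hf.profile n).integrable_cut.mul_bdd hψm hψC
  have hiU : ∀ n, Integrable (fun p : ℝ × ℝ => U n p.1 p.2 * Function.uncurry ψ p) (strip T) :=
    fun n => (hf.profile n).integrable_uncurry.mul_bdd hψm hψC
  rw [strip, integral_prod _ hif] at h1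
  -- The contribution of $[0,\varepsilon_n)$. Its mass is $\rho$ minus the tail mass, and
  -- $\psi(t,x)$ is nearly $\psi(t,0)$ there, so it produces the Dirac term.
  set A : ℕ → ℝ → ℝ := fun n t => ∫ x in Ici 0, (U n t x - cut (ε n) (U n) (t, x)) * ψ t x with hA
  have hiA : ∀ n, Integrable (fun p : ℝ × ℝ => (U n p.1 p.2 - cut (ε n) (U n) p) * ψ p.1 p.2)
      (strip T) := fun n => ((hiU n).sub (hic n)).congr (ae_of_all _ fun p => by
        simp only [Pi.sub_apply, Function.uncurry]; ring)
  have hcutdiff : ∀ n t x, U n t x - cut (ε n) (U n) (t, x) = (Iio (ε n)).indicator (U n t) x :=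
    fun n t x => by
      by_cases hx : ε n ≤ x
      · have : x ∉ Iio (ε n) := not_lt.2 hx
        rw [indicator_of_notMem this, cut, indicator_of_mem (mem_Ici.2 hx), sub_self]
      · rw [indicator_of_mem (mem_Iio.2 (not_le.1 hx)), cut,
          indicator_of_notMem (show x ∉ Ici (ε n) from hx), sub_zero]
  have hslice : ∀ n, ∀ t ∈ Icc 0 T,
      Integrable (fun x => U n t x - cut (ε n) (U n) (t, x)) halfLine := fun n t ht => by
    simp only [hcutdiff]
    exact ((hf.profile n).integrable t ht).indicator measurableSet_Iio
  have hmassdiff : ∀ n, ∀ t ∈ Icc 0 T,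
      ∫ x in Ici 0, (U n t x - cut (ε n) (U n) (t, x)) = ρ - tailMass (ε n) (U n t) :=
    fun n t ht => by
      have i1 := (hf.profile n).integrable t ht
      have i2 : Integrable (fun x => cut (ε n) (U n) (t, x)) halfLine :=
        i1.indicator measurableSet_Ici
      rw [integral_sub i1 i2, (hf.profile n).mass_eq t ht, integral_cut (hf.ε_pos n).le]
  have hbd : ∀ n, ∀ t ∈ Icc 0 T, ∀ B, (∀ x, 0 ≤ x → x < ε n → |ψ t x - ψ t 0| ≤ B) → 0 ≤ B →
      |A n t - (ρ - tailMass (ε n) (U n t)) * ψ t 0| ≤ B * ρ := fun n t ht B hB hB0 => by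
    have hslm := aestronglyMeasurable_slice ht hψ
    have i1 : Integrable (fun x => (U n t x - cut (ε n) (U n) (t, x)) * ψ t x) halfLine :=
      (hslice n t ht).mul_bdd (c := C) hslm (by
        filter_upwards [ae_restrict_mem measurableSet_Ici] with x hx using hC t ht x hx)
    have i2 := (hslice n t ht).mul_const (ψ t 0)
    have e : A n t - (ρ - tailMass (ε n) (U n t)) * ψ t 0
        = ∫ x in Ici 0, (U n t x - cut (ε n) (U n) (t, x)) * (ψ t x - ψ t 0) := by
      rw [← hmassdiff n t ht, ← integral_mul_const, hA, ← integral_sub i1 i2]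
      congr 1; ext x; ring
    rw [e, ← Real.norm_eq_abs]
    calc _ ≤ ∫ x in Ici 0, B * (U n t x - cut (ε n) (U n) (t, x)) := by
          refine norm_integral_le_of_norm_le ((hslice n t ht).const_mul B) ?_
          filter_upwards [ae_restrict_mem measurableSet_Ici] with x hx
          rw [hcutdiff, norm_mul]
          by_cases hx' : x < ε n
          · rw [indicator_of_mem (mem_Iio.2 hx'), Real.norm_of_nonneg ((hf.profile n).nonneg t x),
              mul_comm]
            exact mul_le_mul_of_nonneg_right (hB x hx hx') ((hf.profile n).nonneg t x)
          · rw [indicator_of_notMem (show x ∉ Iio (ε n) from hx')]; simp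
      _ = B * (ρ - tailMass (ε n) (U n t)) := by rw [integral_const_mul, hmassdiff n t ht]
      _ ≤ B * ρ := by
          gcongr; linarith [(hf.profile n).tailMass_nonneg t]
  have hAlim : Tendsto (fun n => ∫ t in Icc 0 T, A n t) atTop
      (𝓝 (∫ t in Icc 0 T, (ρ - mass f t) * ψ t 0)) := by
    -- $2C\rho$ for replacing $\psi(t,x)$ by $\psi(t,0)$, and $C\rho$ for the term at the origin.
    refine tendsto_integral_of_dominated_convergence (fun _ => 3 * C * ρ)
      (fun n => (hiA n).integral_prod_left.aestronglyMeasurable) (integrable_const _)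
      (fun n => ?_) ?_
    · filter_upwards [ae_restrict_mem measurableSet_Icc] with t ht
      have h2 := hbd n t ht (2 * C) (fun x hx _ => by
        calc |ψ t x - ψ t 0| ≤ |ψ t x| + |ψ t 0| := abs_sub _ _
          _ ≤ 2 * C := by linarith [hC t ht x hx, hC t ht 0 (mem_Ici.2 le_rfl)]) (by linarith)
      have h3 : |(ρ - tailMass (ε n) (U n t)) * ψ t 0| ≤ ρ * C := by
        rw [abs_mul]
        have k1 := (hf.profile n).tailMass_nonneg t
        have k2 := (hf.profile n).tailMass_le (hf.ε_pos n).le ht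
        rw [abs_of_nonneg (by linarith)]
        exact mul_le_mul (by linarith) (hC t ht 0 (mem_Ici.2 le_rfl)) (abs_nonneg _) hρ0
      rw [Real.norm_eq_abs]
      calc |A n t| = |(A n t - (ρ - tailMass (ε n) (U n t)) * ψ t 0)
            + (ρ - tailMass (ε n) (U n t)) * ψ t 0| := by rw [sub_add_cancel]
        _ ≤ _ := abs_add_le _ _
        _ ≤ 3 * C * ρ := by linarith
    · filter_upwards [hf.ae_tendsto_tailMass, ae_restrict_mem measurableSet_Icc] with t h2 ht
      have h3 : Tendsto (fun n => (ρ - tailMass (ε n) (U n t)) * ψ t 0) atTop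
          (𝓝 ((ρ - mass f t) * ψ t 0)) := (h2.const_sub ρ).mul_const _
      have h4 : Tendsto (fun n => A n t - (ρ - tailMass (ε n) (U n t)) * ψ t 0) atTop (𝓝 0) := by
        rw [Metric.tendsto_atTop]
        intro δ hδ
        have hcw := (continuousOn_slice ht hψ) 0 (mem_Ici.2 le_rfl)
        have hδ' : 0 < δ / (2 * (ρ + 1)) := by positivity
        obtain ⟨r, hr, hrδ⟩ := Metric.continuousWithinAt_iff.1 hcw _ hδ'
        obtain ⟨N, hN⟩ := Metric.tendsto_atTop.1 hf.ε_lim r hr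
        refine ⟨N, fun n hn => ?_⟩
        have hεn := hN n hn
        rw [Real.dist_eq, sub_zero, abs_of_pos (hf.ε_pos n)] at hεn
        rw [Real.dist_eq, sub_zero]
        refine (hbd n t ht (δ / (2 * (ρ + 1))) (fun x hx hx' => ?_) hδ'.le).trans_lt ?_
        · have := hrδ (x := x) (mem_Ici.2 hx) (by
            rw [Real.dist_eq, sub_zero, abs_of_nonneg hx]; linarith)
          rw [Real.dist_eq] at this
          exact this.le
        · rw [div_mul_eq_mul_div, div_lt_iff₀ (by positivity)]
          nlinarith
      simpa using h4.add h3
  refine (h1.add hAlim).congr fun n => ?_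
  rw [integral_prod _ (hic n), ← integral_add (hic n).integral_prod_left (hiA n).integral_prod_left]
  refine integral_congr_ae ?_
  filter_upwards [(hic n).prod_right_ae, (hiA n).prod_right_ae] with t k1 k2
  rw [← integral_add k1 k2]
  congr 1; ext x; simp only [Function.uncurry]; ring

lemma tendsto_secondDiff {φ φt φx φxx : ℝ → ℝ → ℝ} (hφ : IsTestFunction T φ φt φx φxx)
    (hε : ∀ n, 0 < ε n) (hε0 : Tendsto ε atTop (𝓝 0)) {t x : ℝ} (ht : t ∈ Icc 0 T) (hx : 0 < x) :
    Tendsto (fun n => (ε n ^ 2)⁻¹ * secondDiff (ε n) φ t x) atTop (𝓝 (φxx t x)) := by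
  rw [Metric.tendsto_atTop]
  intro δ hδ
  have hcw := (continuousOn_slice ht (hφ.continuousOn φxx (by simp))) x (mem_Ici.2 hx.le)
  obtain ⟨r, hr, hrδ⟩ := Metric.continuousWithinAt_iff.1 hcw δ hδ
  obtain ⟨N, hN⟩ := Metric.tendsto_atTop.1 hε0 (min r x) (lt_min hr hx)
  refine ⟨N, fun n hn => ?_⟩
  have hεn := hN n hn
  rw [Real.dist_eq, sub_zero, abs_of_pos (hε n)] at hεn
  obtain ⟨ξ, hξ, hξ0, e⟩ := exists_secondDiff_eq hφ ht (hε n) (hεn.le.trans (min_le_right _ _))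
  have hne : ε n ^ 2 ≠ 0 := pow_ne_zero 2 (hε n).ne'
  rw [e, inv_mul_cancel_left₀ hne]
  refine hrδ (mem_Ici.2 hξ0) ?_
  rw [Real.dist_eq, abs_lt]
  have := hεn.trans_le (min_le_left _ _)
  constructor <;> linarith [hξ.1, hξ.2]

lemma abs_secondDiff_div_le {φ φt φx φxx : ℝ → ℝ → ℝ} (hφ : IsTestFunction T φ φt φx φxx)
    {C t x ε' : ℝ} (ht : t ∈ Icc 0 T) (hC : ∀ x ∈ Ici (0 : ℝ), |φxx t x| ≤ C) (hε : 0 < ε') :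
    |(ε' ^ 2)⁻¹ * secondDiff ε' φ t x| ≤ C := by
  by_cases hx : ε' ≤ x
  · obtain ⟨ξ, hξ, hξ0, e⟩ := exists_secondDiff_eq hφ ht hε hx
    rw [e, inv_mul_cancel_left₀ (pow_ne_zero 2 hε.ne')]
    exact hC ξ hξ0
  · rw [secondDiff, indicator_of_notMem (show x ∉ Ici ε' from hx), mul_zero, abs_zero]
    exact (abs_nonneg _).trans (hC 0 (mem_Ici.2 le_rfl))

lemma IsWeakLimit.integrable_nonlinear (hf : IsWeakLimit η T M h ε U f)
    {φ φt φx φxx : ℝ → ℝ → ℝ} (hφ : IsTestFunction T φ φt φx φxx) :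
    Integrable (fun p : ℝ × ℝ => f p.1 p.2 * (mass f p.1 * φxx p.1 p.2)) (strip T) := by
  obtain ⟨C, hC⟩ := hφ.bounded φxx (by simp)
  have hm : AEStronglyMeasurable (fun p : ℝ × ℝ => mass f p.1 * φxx p.1 p.2) (strip T) :=
    (hf.integrable_mass.aestronglyMeasurable.comp_fst).mul
      (aestronglyMeasurable_strip (hφ.continuousOn φxx (by simp)))
  refine hf.integrable.mul_bdd (c := (∫ x in Ici 0, h x) * C) hm ?_
  have : ∀ᵐ p ∂strip T, mass f p.1 ≤ ∫ x in Ici 0, h x :=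
    Measure.quasiMeasurePreserving_fst.ae hf.ae_mass_le
  filter_upwards [ae_strip_mem T, this] with p hp h1
  rw [norm_mul, Real.norm_of_nonneg (hf.mass_nonneg _)]
  exact mul_le_mul h1 (hC _ hp.1 _ hp.2) (norm_nonneg _) hf.mass_bound_nonneg

/-- The tail mass times the rescaled second difference is treated as one test function: it is
bounded uniformly in `n` and converges almost everywhere, so no product of two weak limits occurs.
-/
lemma IsWeakLimit.tendsto_nonlinear (hf : IsWeakLimit η T M h ε U f)
    {φ φt φx φxx : ℝ → ℝ → ℝ} (hφ : IsTestFunction T φ φt φx φxx) :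
    Tendsto (fun n => η / (3 * ε n ^ 2) * ∫ t in Icc 0 T, tailMass (ε n) (U n t) *
        ∫ x in Ici 0, U n t x * secondDiff (ε n) φ t x) atTop
      (𝓝 (η / 3 * ∫ t in Icc 0 T, mass f t * ∫ x in Ici 0, f t x * φxx t x)) := by
  obtain ⟨C, hC⟩ := hφ.bounded φxx (by simp)
  have h0T : (0 : ℝ) ∈ Icc 0 T := ⟨le_rfl, hf.T_pos.le⟩
  have hC0 : 0 ≤ C := (abs_nonneg _).trans (hC 0 h0T 0 (mem_Ici.2 le_rfl))
  have hρ0 := hf.mass_bound_nonneg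
  set ψ : ℕ → ℝ → ℝ → ℝ := fun n t x =>
    tailMass (ε n) (U n t) * ((ε n ^ 2)⁻¹ * secondDiff (ε n) φ t x) with hψ
  have hm : ∀ n, AEStronglyMeasurable (fun p : ℝ × ℝ => ψ n p.1 p.2) (strip T) := fun n =>
    (((hf.profile n).measurable_tailMass.comp measurable_fst).aestronglyMeasurable).mul
      ((aestronglyMeasurable_secondDiff hf.T_pos.le (hf.ε_pos n)
        (hφ.continuousOn φ (by simp))).const_mul _)
  have hb : ∀ n, ∀ᵐ p ∂strip T, |ψ n p.1 p.2| ≤ (∫ x in Ici 0, h x) * C := fun n => by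
    filter_upwards [ae_strip_mem T] with p hp
    simp only [hψ]
    rw [abs_mul, abs_of_nonneg ((hf.profile n).tailMass_nonneg _)]
    exact mul_le_mul ((hf.profile n).tailMass_le (hf.ε_pos n).le hp.1)
      (abs_secondDiff_div_le hφ hp.1 (hC _ hp.1) (hf.ε_pos n)) (abs_nonneg _) hρ0
  have hlim : ∀ᵐ p ∂strip T, Tendsto (fun n => ψ n p.1 p.2) atTop
      (𝓝 (mass f p.1 * φxx p.1 p.2)) := by
    have h1 : ∀ᵐ p ∂strip T, Tendsto (fun n => tailMass (ε n) (U n p.1)) atTop (𝓝 (mass f p.1)) :=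
      Measure.quasiMeasurePreserving_fst.ae hf.ae_tendsto_tailMass
    have h2 : ∀ᵐ p ∂strip T, p.2 ≠ 0 :=
      Measure.quasiMeasurePreserving_snd.ae (ae_restrict_of_ae (volume.ae_ne 0))
    filter_upwards [h1, h2, ae_strip_mem T] with p k1 k2 k3
    exact k1.mul (tendsto_secondDiff hφ hf.ε_pos hf.ε_lim k3.1 (lt_of_le_of_ne k3.2 k2.symm))
  have hmain := (hf.tendsto (ψ := fun n p => ψ n p.1 p.2) (mul_nonneg hρ0 hC0) hm hb hlim).const_mul
    (η / 3)
  have hifn := hf.integrable_nonlinear hφ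
  rw [strip, integral_prod _ hifn] at hmain
  have e : ∀ t, ∫ x in Ici 0, f t x * (mass f t * φxx t x)
      = mass f t * ∫ x in Ici 0, f t x * φxx t x := fun t => by
    rw [← integral_const_mul]; congr 1; ext x; ring
  simp only [e] at hmain
  refine hmain.congr fun n => ?_
  have hic : Integrable (fun p => cut (ε n) (U n) p * ψ n p.1 p.2) (strip T) :=
    (hf.profile n).integrable_cut.mul_bdd (hm n) (hb n)
  rw [integral_prod _ hic, ← integral_const_mul, ← integral_const_mul]
  congr 1; ext t
  have hεn := (hf.ε_pos n).ne'
  rw [← mul_assoc, ← integral_const_mul, ← integral_const_mul]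
  congr 1; ext x
  simp only [hψ]
  -- The second difference is cut off below $\varepsilon_n$, so the profile and its truncation give
  -- the same integrand.
  by_cases hx : x ∈ Ici (ε n)
  · rw [cut, indicator_of_mem hx]; field_simp
  · rw [secondDiff, indicator_of_notMem hx]; simp

/-- The limit satisfies the very weak formulation. -/
lemma IsWeakLimit.equation (hf : IsWeakLimit η T M h ε U f)
    {φ φt φx φxx : ℝ → ℝ → ℝ} (hφ : IsTestFunction T φ φt φx φxx) :
    (∫ t in Icc 0 T, ∫ x in Ici 0, f t x * φt t x)
      + η / 3 * (∫ t in Icc 0 T, mass f t * ∫ x in Ici 0, f t x * φxx t x)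
      + (∫ x in Ici 0, h x * φ 0 x) = 0 := by
  obtain ⟨C, hC⟩ := hφ.bounded φt (by simp)
  have h1 := hf.tendsto_full (hφ.continuousOn φt (by simp)) hC
  -- This removes the Dirac part from the limit equation: $\varphi(\cdot,0)$ vanishes identically.
  have hb : ∀ t ∈ Icc 0 T, φt t 0 = 0 := fun t ht => by
    have k1 := hφ.hasDeriv_t t ht 0 (mem_Ici.2 le_rfl)
    have k2 : HasDerivWithinAt (fun s => φ s 0) 0 (Icc 0 T) t :=
      (hasDerivWithinAt_const t (Icc 0 T) (0 : ℝ)).congr_of_mem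
        (fun s hs => hφ.boundary s hs) ht
    exact (uniqueDiffOn_Icc hf.T_pos t ht).eq_deriv _ k1 k2
  have h2 : ∫ t in Icc 0 T, ((∫ x in Ici 0, h x) - mass f t) * φt t 0 = 0 := by
    refine (integral_congr_ae ?_).trans (integral_zero _ _)
    filter_upwards [ae_restrict_mem measurableSet_Icc] with t ht
    rw [hb t ht, mul_zero]
  rw [h2, add_zero] at h1
  refine tendsto_nhds_unique ((h1.add (hf.tendsto_nonlinear hφ)).add_const _) ?_
  exact tendsto_const_nhds.congr fun n => ((hf.profile n).weak φ φt φx φxx hφ).symm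

end limit

section limit
variable {η T M : ℝ} {h : ℝ → ℝ} {ε : ℕ → ℝ} {U : ℕ → ℝ → ℝ → ℝ} {f : ℝ → ℝ → ℝ}

/-! ### The boundary value at the origin. -/

/-- The barrier near the origin: `x / L` plus a term decaying like `exp (-c t β / L²)`. -/
noncomputable def originBarrier (η M L : ℝ) (β : ℝ → ℝ) (p : ℝ × ℝ) : ℝ :=
  M * (p.2 / L + Real.exp (-(4 * η / (3 * Real.pi ^ 2) / L ^ 2 * (p.1 * β p.1))))

/-- The inequality $1-\cos y\ge 2y^2/\pi^2$ at $y=\varepsilon'/L$ cancels the $\varepsilon'^{-2}$ in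
the speed and makes the exponent independent of $\varepsilon'$. -/
lemma IsProfile.cut_le_originBarrier {ε' L : ℝ} {V : ℝ → ℝ → ℝ} (hη : 0 ≤ η) (hM : 0 ≤ M)
    (hε : 0 < ε') (hL : 0 < L) (hεL : ε' ≤ L / 2) (hV : IsProfile η T ε' M h V) {p : ℝ × ℝ}
    (hp : p.1 ∈ Icc 0 T) (hp0 : 0 ≤ p.2) (hpL : p.2 ≤ L) :
    cut ε' V p ≤ originBarrier η M L (fun t => tailMass ε' (V t)) p := by
  by_cases hx : ε' ≤ p.2
  · rw [cut, indicator_of_mem (mem_Ici.2 hx)]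
    refine (hV.barrier p.1 hp L hL hεL p.2 hx hpL).trans ?_
    unfold originBarrier
    have hβ := hV.tailMass_nonneg p.1
    have hq0 : 0 < ε' / L := div_pos hε hL
    have hq1 : ε' / L ≤ 1 / 2 := by rw [div_le_iff₀ hL]; linarith
    have hcos := Real.cos_le_one_sub_mul_cos_sq (x := ε' / L) (by
      rw [abs_of_pos hq0]; linarith [Real.pi_gt_three])
    have hcoef : 0 ≤ 2 * (η / (3 * ε' ^ 2) * p.1 * tailMass ε' (V p.1)) := by
      have := hp.1; positivity
    have key : 4 * η / (3 * Real.pi ^ 2) / L ^ 2 * (p.1 * tailMass ε' (V p.1))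
        ≤ 2 * (η / (3 * ε' ^ 2) * p.1 * tailMass ε' (V p.1)) * (1 - Real.cos (ε' / L)) := by
      calc _ = 2 * (η / (3 * ε' ^ 2) * p.1 * tailMass ε' (V p.1))
            * (2 / Real.pi ^ 2 * (ε' / L) ^ 2) := by
            have := Real.pi_pos.ne'
            field_simp
            ring
        _ ≤ _ := by gcongr; linarith
    gcongr
  · rw [cut, indicator_of_notMem (show p.2 ∉ Ici ε' from hx)]
    unfold originBarrier
    positivity

/-- The inequality is integrated over arbitrary sets: the left side converges weakly, the right side
by dominated convergence, since the tail masses converge almost everywhere. -/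
lemma IsWeakLimit.ae_le_originBarrier (hf : IsWeakLimit η T M h ε U f) {L : ℝ} (hL : 0 < L) :
    ∀ᵐ p ∂strip T, p.2 ≤ L → f p.1 p.2 ≤ originBarrier η M L (mass f) p := by
  have hM0 := hf.datum.bound_nonneg
  have hη := hf.η_pos
  set S : Set (ℝ × ℝ) := {p | p.2 ≤ L} with hS
  have hSm : MeasurableSet S := measurableSet_le measurable_snd measurable_const
  have hSfin : IsFiniteMeasure ((strip T).restrict S) :=
    ⟨by
      rw [Measure.restrict_apply_univ]
      refine lt_of_le_of_lt (measure_mono fun p (hp : p.2 ≤ L) => ?_) (strip_lt_top (L + 1))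
      exact lt_of_le_of_lt hp (lt_add_one L)⟩
  refine (ae_restrict_iff' hSm).1 ?_
  have hmeas : ∀ {β : ℝ → ℝ}, Measurable β → Measurable (originBarrier η M L β) := fun hβ => by
    unfold originBarrier
    have := hβ.comp (measurable_fst : Measurable (Prod.fst : ℝ × ℝ → ℝ))
    fun_prop
  have hmm : Measurable (mass f) :=
    (hf.measurable.stronglyMeasurable.integral_prod_right (ν := halfLine)).measurable
  have hbd : ∀ {β : ℝ → ℝ}, (∀ t, 0 ≤ β t) → ∀ᵐ p ∂(strip T).restrict S,
      ‖originBarrier η M L β p‖ ≤ M * 2 := fun {β} hβ => by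
    filter_upwards [ae_restrict_of_ae (ae_strip_mem T), ae_restrict_mem hSm] with p hp hpS
    have h1 : 0 ≤ p.2 / L := div_nonneg hp.2 hL.le
    have h2 : p.2 / L ≤ 1 := (div_le_one hL).2 hpS
    have h3 : Real.exp (-(4 * η / (3 * Real.pi ^ 2) / L ^ 2 * (p.1 * β p.1))) ≤ 1 := by
      rw [Real.exp_le_one_iff]
      have := hβ p.1; have := hp.1.1
      have : 0 ≤ 4 * η / (3 * Real.pi ^ 2) / L ^ 2 * (p.1 * β p.1) := by positivity
      linarith
    unfold originBarrier
    rw [Real.norm_of_nonneg (mul_nonneg hM0 (add_nonneg h1 (Real.exp_pos _).le))]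
    gcongr; linarith
  have hint : ∀ {β : ℝ → ℝ}, Measurable β → (∀ t, 0 ≤ β t) →
      Integrable (originBarrier η M L β) ((strip T).restrict S) := fun hβm hβ0 =>
    Integrable.of_bound (hmeas hβm).aestronglyMeasurable _ (hbd hβ0)
  refine ae_le_of_forall_setIntegral_le hf.integrable.integrableOn (hint hmm hf.mass_nonneg)
    fun s hs _ => ?_
  have h1 := hf.tendsto (ψ := fun _ => (s ∩ S).indicator (fun _ => (1 : ℝ))) zero_le_one
    (fun _ => (measurable_const.indicator (hs.inter hSm)).aestronglyMeasurable)
    (fun _ => ae_of_all _ fun p => by simp only [indicator]; split_ifs <;> simp)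
    (ae_of_all _ fun p => tendsto_const_nhds)
  have e : ∀ k : ℝ × ℝ → ℝ, ∫ p, k p * (s ∩ S).indicator (fun _ => (1 : ℝ)) p ∂strip T
      = ∫ p in s, k p ∂(strip T).restrict S := fun k => by
    rw [Measure.restrict_restrict hs, ← integral_indicator (hs.inter hSm)]
    congr 1; ext p; simp only [indicator]; split_ifs <;> simp
  simp only [e] at h1
  have h2 : Tendsto (fun n => ∫ p in s, originBarrier η M L (fun t => tailMass (ε n) (U n t)) p
      ∂(strip T).restrict S) atTop
      (𝓝 (∫ p in s, originBarrier η M L (mass f) p ∂(strip T).restrict S)) := by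
    refine tendsto_integral_of_dominated_convergence (fun _ => M * 2)
      (fun n => (hmeas (hf.profile n).measurable_tailMass).aestronglyMeasurable)
      (integrable_const _) (fun n => ae_restrict_of_ae (hbd (hf.profile n).tailMass_nonneg)) ?_
    have h3 : ∀ᵐ p ∂strip T, Tendsto (fun n => tailMass (ε n) (U n p.1)) atTop (𝓝 (mass f p.1)) :=
      Measure.quasiMeasurePreserving_fst.ae hf.ae_tendsto_tailMass
    filter_upwards [ae_restrict_of_ae (ae_restrict_of_ae h3)] with p hp
    unfold originBarrier
    exact (((((hp.const_mul p.1).const_mul _).neg).rexp).const_add _).const_mul M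
  refine le_of_tendsto_of_tendsto h1 h2 ?_
  have hev : ∀ᶠ n in atTop, ε n ≤ L / 2 :=
    (hf.ε_lim.eventually (gt_mem_nhds (half_pos hL))).mono fun n hn => hn.le
  filter_upwards [hev] with n hn
  refine setIntegral_mono_ae_restrict (hf.profile n).integrable_cut.integrableOn.integrableOn
    (hint (hf.profile n).measurable_tailMass (hf.profile n).tailMass_nonneg).integrableOn ?_
  filter_upwards [ae_restrict_of_ae (ae_restrict_of_ae (ae_strip_mem T)),
    ae_restrict_of_ae (ae_restrict_mem hSm)] with p hp hpS
  exact (hf.profile n).cut_le_originBarrier hη.le hM0 (hf.ε_pos n) hL hn hp.1 hp.2 hpS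

/-- The boundary value zero is attained in the sense of averages. -/
lemma IsWeakLimit.trace_zero (hf : IsWeakLimit η T M h ε U f) :
    ∀ᵐ t ∂(volume.restrict (Icc 0 T)),
      Tendsto (fun δ : ℝ => δ⁻¹ * ∫ x in Ioc 0 δ, |f t x|) (𝓝[>] 0) (𝓝 0) := by
  have hM0 := hf.datum.bound_nonneg
  have hη := hf.η_pos
  -- The barrier holds almost everywhere for each $L$, so $L$ is restricted to the countable family
  -- $1/(k+1)$ to obtain a common null set of times.
  have hall : ∀ᵐ t ∂(volume.restrict (Icc 0 T)), ∀ k : ℕ, ∀ᵐ x ∂halfLine,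
      x ≤ ((k : ℝ) + 1)⁻¹ → f t x ≤ originBarrier η M ((k : ℝ) + 1)⁻¹ (mass f) (t, x) :=
    ae_all_iff.2 fun k => Measure.ae_ae_of_ae_prod
      (hf.ae_le_originBarrier (L := ((k : ℝ) + 1)⁻¹) (by positivity))
  filter_upwards [hall, ae_restrict_mem measurableSet_Icc, hf.ae_integrable_slice,
    ae_restrict_of_ae (volume.ae_ne (0 : ℝ))] with t hk ht hi ht0
  have htpos : 0 < t := lt_of_le_of_ne ht.1 ht0.symm
  -- Without mass the exponential does not decay, but then $f(t,\cdot)$ itself vanishes almost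
  -- everywhere.
  rcases (hf.mass_nonneg t).eq_or_lt with hβ | hβ
  · have hz : f t =ᵐ[halfLine] 0 :=
      (integral_eq_zero_iff_of_nonneg (hf.nonneg t) hi).1 hβ.symm
    refine tendsto_const_nhds.congr fun δ => ?_
    have : ∫ x in Ioc 0 δ, |f t x| = 0 := by
      refine (integral_congr_ae ?_).trans (integral_zero _ _)
      filter_upwards [ae_mono (Measure.restrict_mono
        (Ioc_subset_Icc_self.trans Icc_subset_Ici_self : Ioc 0 δ ⊆ Ici 0) le_rfl) hz] with x hx
      rw [hx, Pi.zero_apply, abs_zero]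
    rw [this, mul_zero]
  set a := 4 * η / (3 * Real.pi ^ 2) * (t * mass f t) with ha
  have ha0 : 0 < a := by have := Real.pi_pos; positivity
  have hexp : Tendsto (fun k : ℕ => M * Real.exp (-(a * ((k : ℝ) + 1) ^ 2))) atTop (𝓝 0) := by
    have h1 : Tendsto (fun k : ℕ => a * ((k : ℝ) + 1) ^ 2) atTop atTop :=
      ((tendsto_pow_atTop two_ne_zero).comp
        (tendsto_atTop_add_const_right _ 1 tendsto_natCast_atTop_atTop)).const_mul_atTop ha0
    simpa using (Real.tendsto_exp_neg_atTop_nhds_zero.comp h1).const_mul M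
  rw [Metric.tendsto_nhds]
  intro γ hγ
  -- $L=1/(k+1)$ is fixed first, to make the exponential small; $\delta$ is then chosen small
  -- relative to $L$ to control the linear term.
  obtain ⟨k, hkγ⟩ := (hexp.eventually (gt_mem_nhds (half_pos hγ))).exists
  have hK : (0 : ℝ) < (k : ℝ) + 1 := by positivity
  have hlin : Tendsto (fun δ : ℝ => M * (δ * ((k : ℝ) + 1))) (𝓝[>] 0) (𝓝 0) := by
    have : Continuous fun δ : ℝ => M * (δ * ((k : ℝ) + 1)) := by fun_prop
    simpa using (this.tendsto 0).mono_left nhdsWithin_le_nhds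
  filter_upwards [hlin.eventually (gt_mem_nhds (half_pos hγ)), self_mem_nhdsWithin,
    Ioo_mem_nhdsGT (inv_pos.2 hK)] with δ h1 h2 h3
  have hδ : 0 < δ := h2
  set B := M * (δ * ((k : ℝ) + 1)) + M * Real.exp (-(a * ((k : ℝ) + 1) ^ 2)) with hB
  have hBγ : B < γ := by linarith
  have hle : ‖∫ x in Ioc 0 δ, |f t x|‖ ≤ B * volume.real (Ioc 0 δ) := by
    refine norm_setIntegral_le_of_norm_le_const_ae' measure_Ioc_lt_top ?_
    filter_upwards [(ae_restrict_iff' measurableSet_Ici).1 (hk k)] with x hx hxδ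
    have hx1 := hx (mem_Ici.2 hxδ.1.le) (hxδ.2.trans h3.2.le)
    rw [Real.norm_eq_abs, abs_abs, abs_of_nonneg (hf.nonneg t x)]
    refine hx1.trans ?_
    simp only [originBarrier, hB, div_inv_eq_mul, inv_pow, ← mul_add]
    have e : 4 * η / (3 * Real.pi ^ 2) * ((k : ℝ) + 1) ^ 2 * (t * mass f t)
        = a * ((k : ℝ) + 1) ^ 2 := by rw [ha]; ring
    rw [e]
    gcongr
    exact hxδ.2
  rw [Real.volume_real_Ioc_of_le hδ.le, sub_zero] at hle
  rw [Real.dist_eq, sub_zero, abs_mul, abs_of_pos (inv_pos.2 hδ), inv_mul_lt_iff₀ hδ, mul_comm]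
  rw [Real.norm_eq_abs] at hle
  exact hle.trans_lt (by gcongr)

/-! ### The limit measure and the conclusion. -/

lemma IsWeakLimit.isVeryWeakSolution (hf : IsWeakLimit η T M h ε U f) {fin : ℝ → ℝ}
    (hfin : fin =ᵐ[halfLine] h) : IsVeryWeakSolution η T fin f where
  measurable := hf.measurable
  integrable := by
    rw [IntegrableOn, volume_restrict_strip]; exact hf.integrable
  nonlinear_integrable := fun φ φt φx φxx hφ => by
    refine (hf.integrable_nonlinear hφ).integral_prod_left.congr (ae_of_all _ fun t => ?_)
    simp only
    rw [← integral_const_mul]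
    congr 1; ext x; ring
  equation := fun φ φt φx φxx hφ => by
    have e : ∫ x in Ici 0, fin x * φ 0 x = ∫ x in Ici 0, h x * φ 0 x := by
      refine integral_congr_ae ?_
      filter_upwards [hfin] with x hx
      rw [hx]
    rw [e]; exact hf.equation hφ
  trace_zero := hf.trace_zero

lemma IsWeakLimit.isFiniteMeasure_limitMeasure (hf : IsWeakLimit η T M h ε U f) (ρ : ℝ) :
    IsFiniteMeasure ((volume.restrict (Icc 0 T ×ˢ Ici 0)).withDensity
      (fun p => ENNReal.ofReal (f p.1 p.2))) ∧
    IsFiniteMeasure ((volume.restrict (Icc 0 T)).withDensity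
      (fun t => ENNReal.ofReal (ρ - mass f t))) := by
  rw [volume_restrict_strip]
  exact ⟨isFiniteMeasure_withDensity_ofReal hf.integrable.2,
    isFiniteMeasure_withDensity_ofReal ((integrable_const ρ).sub hf.integrable_mass).2⟩

lemma IsWeakLimit.integral_limitMeasure (hf : IsWeakLimit η T M h ε U f) (ψ : ℝ × ℝ →ᵇ ℝ) :
    ∫ p, ψ p ∂(limitMeasure T (∫ x in Ici 0, h x) f)
      = (∫ t in Icc 0 T, ∫ x in Ici 0, f t x * ψ (t, x))
        + ∫ t in Icc 0 T, ((∫ x in Ici 0, h x) - mass f t) * ψ (t, 0) := by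
  set ρ := ∫ x in Ici 0, h x with hρ
  obtain ⟨h1, h2⟩ := hf.isFiniteMeasure_limitMeasure ρ
  have hmm : Measurable (mass f) :=
    (hf.measurable.stronglyMeasurable.integral_prod_right (ν := halfLine)).measurable
  rw [limitMeasure, integral_add_measure (ψ.integrable _) (ψ.integrable _)]
  congr 1
  · have hfm : Measurable fun p : ℝ × ℝ => ENNReal.ofReal (f p.1 p.2) :=
      hf.measurable.ennreal_ofReal
    rw [integral_withDensity_eq_integral_toReal_smul hfm
      (ae_of_all _ fun p => ENNReal.ofReal_lt_top), volume_restrict_strip]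
    have e : ∀ p : ℝ × ℝ, (ENNReal.ofReal (f p.1 p.2)).toReal • ψ p = f p.1 p.2 * ψ p := fun p => by
      rw [ENNReal.toReal_ofReal (hf.nonneg _ _), smul_eq_mul]
    simp only [e]
    exact integral_prod _ (hf.integrable.mul_bdd ψ.continuous.aestronglyMeasurable
      (ae_of_all _ fun p => ψ.norm_coe_le_norm p))
  · rw [Measure.prod_dirac, integral_map (by fun_prop) ψ.continuous.aestronglyMeasurable,
      integral_withDensity_eq_integral_toReal_smul (hmm.const_sub ρ).ennreal_ofReal
      (ae_of_all _ fun p => ENNReal.ofReal_lt_top)]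
    refine integral_congr_ae ?_
    -- The truncation in `ENNReal.ofReal` is harmless because the limiting mass does not exceed
    -- $\rho$.
    filter_upwards [hf.ae_mass_le] with t ht
    rw [ENNReal.toReal_ofReal (sub_nonneg.2 ht), smul_eq_mul]

end limit

/-- Clipping a measurable representative to $[0,\|f^{\mathrm{in}}\|_\infty]$ changes it only on a
null set, and the pointwise iteration of the walk requires bounds at every point. -/
lemma exists_isDatum {fin : ℝ → ℝ} (h1 : MemLp fin 1 halfLine) (h_top : MemLp fin ∞ halfLine)
    (h0 : ∀ᵐ x ∂halfLine, 0 ≤ fin x) : ∃ (M : ℝ) (h : ℝ → ℝ), IsDatum M h ∧ fin =ᵐ[halfLine] h := by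
  set M := (eLpNorm fin ∞ halfLine).toReal with hM
  have hb : ∀ᵐ x ∂halfLine, ‖fin x‖ ≤ M := by
    filter_upwards [ae_le_eLpNormEssSup (f := fin) (μ := halfLine)] with x hx
    have := ENNReal.toReal_mono h_top.2.ne (hx.trans_eq eLpNorm_exponent_top.symm)
    rwa [toReal_enorm] at this
  obtain ⟨g, hgm, hg⟩ := h1.1
  have hae : fin =ᵐ[halfLine] fun x => min (max (g x) 0) M := by
    filter_upwards [hg, hb, h0] with x e1 e2 e3
    rw [Real.norm_of_nonneg e3] at e2
    rw [← e1, max_eq_left e3, min_eq_left e2]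
  exact ⟨M, _, ⟨(hgm.measurable.max measurable_const).min measurable_const,
    fun x => le_min (le_max_right _ _) ENNReal.toReal_nonneg, fun x => min_le_right _ _,
    (memLp_one_iff_integrable.1 h1).congr hae⟩, hae⟩

lemma IsKineticSolution.congr_initial {η T ε : ℝ} {fin h : ℝ → ℝ} {u : ℝ → L1}
    (hu : IsKineticSolution η T ε fin u) (hfin : fin =ᵐ[halfLine] h) :
    IsKineticSolution η T ε h u :=
  ⟨hu.continuousOn, hu.initial.trans hfin, hu.equation⟩

lemma exists_isKineticSolution {η T ε M : ℝ} {h : ℝ → ℝ} (hη : 0 < η) (hT : 0 < T) (hε : 0 < ε)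
    (hh : IsDatum M h) : ∃ u, IsKineticSolution η T ε h u := by
  obtain ⟨J, hJ⟩ := exists_jumpL hε
  have hF := hh.integrable.coeFn_toL1
  obtain ⟨τ, -, hτ0, -, hτ⟩ := exists_timeChange hε (K := η / (3 * ε ^ 2)) (by positivity)
    hT hJ hh hF
  exact ⟨_, isKineticSolution_timeChange hJ hF hτ0 hτ⟩

end ConstrainedKinetic

theorem mainTheorem1 (η T : ℝ) (hη : 0 < η) (hT : 0 < T) (fin : ℝ → ℝ)
    (hfin_one : MemLp fin 1 ConstrainedKinetic.halfLine)
    (hfin_top : MemLp fin ∞ ConstrainedKinetic.halfLine)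
    (hfin_nonneg : ∀ᵐ x ∂ConstrainedKinetic.halfLine, 0 ≤ fin x) :
    (∀ ε : ℝ, 0 < ε → ∃ u : ℝ → ConstrainedKinetic.L1,
      ConstrainedKinetic.IsKineticSolution η T ε fin u ∧
        ∀ v, ConstrainedKinetic.IsKineticSolution η T ε fin v → EqOn v u (Icc 0 T)) ∧
    ∀ u : ℝ → ℝ → ConstrainedKinetic.L1,
      (∀ ε : ℝ, 0 < ε → ConstrainedKinetic.IsKineticSolution η T ε fin (u ε)) →
      ∀ ε : ℕ → ℝ, (∀ n, 0 < ε n) → Tendsto ε atTop (𝓝 0) →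
      ∃ (σ : ℕ → ℕ) (f : ℝ → ℝ → ℝ), StrictMono σ ∧
        ConstrainedKinetic.IsVeryWeakSolution η T fin f ∧
        (∀ᵐ p ∂(volume.restrict (Icc (0 : ℝ) T ×ˢ Ici (0 : ℝ))), 0 ≤ f p.1 p.2) ∧
        (∀ᵐ t ∂(volume.restrict (Icc (0 : ℝ) T)),
          ConstrainedKinetic.mass f t ≤ ∫ x in Ici 0, ‖fin x‖) ∧
        IsFiniteMeasure
          (ConstrainedKinetic.limitMeasure T (∫ x in Ici 0, ‖fin x‖) f) ∧
        ∀ ψ : ℝ × ℝ →ᵇ ℝ,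
          Tendsto
            (fun n => ∫ t in Icc 0 T, ∫ x in Ici 0, (u (ε (σ n)) t : ℝ → ℝ) x * ψ (t, x))
            atTop
            (𝓝 (∫ p, ψ p ∂(ConstrainedKinetic.limitMeasure T (∫ x in Ici 0, ‖fin x‖) f))) := by
  obtain ⟨M, h, hh, hae⟩ := ConstrainedKinetic.exists_isDatum hfin_one hfin_top hfin_nonneg
  refine ⟨fun ε hε => ?_, fun u hu ε hε hε0 => ?_⟩
  · obtain ⟨u, hu⟩ := ConstrainedKinetic.exists_isKineticSolution hη hT hε hh
    have hu' := hu.congr_initial hae.symm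
    exact ⟨u, hu', fun v hv => hu'.eqOn hε hv⟩
  have hρ : ∫ x in Ici 0, ‖fin x‖ = ∫ x in Ici 0, h x := by
    refine integral_congr_ae ?_
    filter_upwards [hae] with x hx
    rw [hx, Real.norm_of_nonneg (hh.nonneg x)]
  -- The family of solutions is arbitrary; uniqueness, inside `exists_profile`, is what gives its
  -- members the explicit form.
  have hprof := fun n => ((hu (ε n) (hε n)).congr_initial hae).exists_profile hη hT (hε n) hh
  choose U hU hUu using hprof
  obtain ⟨σ, f, hσ, hf⟩ := ConstrainedKinetic.exists_isWeakLimit hη hT hh hε hε0 hU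
  rw [hρ]
  refine ⟨σ, f, hσ, hf.isVeryWeakSolution hae, ae_of_all _ fun p => hf.nonneg _ _, hf.ae_mass_le,
    ?_, fun ψ => ?_⟩
  · obtain ⟨h1, h2⟩ := hf.isFiniteMeasure_limitMeasure (∫ x in Ici 0, h x)
    rw [ConstrainedKinetic.limitMeasure]
    infer_instance
  · rw [hf.integral_limitMeasure ψ]
    refine (hf.tendsto_full (ψ := fun t x => ψ (t, x)) (C := ‖ψ‖) ψ.continuous.continuousOn
      (fun t _ x _ => ψ.norm_coe_le_norm (t, x))).congr fun n => ?_
    refine integral_congr_ae ?_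
    filter_upwards [ae_restrict_mem measurableSet_Icc] with t ht
    refine integral_congr_ae ?_
    filter_upwards [hUu (σ n) t ht] with x hx
    rw [hx]
    rfl
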